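/- Let $n\ge 2$ and $\mathbb G^n=(0,1)^n$. A differentiation basis $B$ in $\mathbb R^n$ assigns to every $x\in\mathbb R^n$ a family $B(x)$ of bounded measurable sets of positive measure containing $x$, such that some sequence $R_k\in B(x)$ has $\operatorname{diam} R_k\to 0$. It is translation invariant if $B(x)=\{x+I: I\in B(0)\}$ for all $x$. For a rotation $\gamma$ of $\mathbb R^n$ put $B(\gamma)(x)=\{x+\gamma(I-x): I\in B(x)\}$, and let $\Delta(B)$ be the family of all $B(\gamma)$. Put $$M_B^{(r)}f(x)=\sup_{R\in B(x),\ \operatorname{diam}R<r}\frac1{|R|}\int_R|f|,\qquad \Phi_B(h)=\lim_{t\to\infty}\limsup_{r\to0+}\frac{|\{M_B^{(tr)}(h\chi_{V_r})>1\}|}{|V_r|}\in[0,\infty],$$ where $V_r$ is the ball of radius $r$ centred at $0$. Let $S_{\Delta(B)}$ be the set of all integrable $f:\mathbb R^n\to\mathbb R$ vanishing outside $\mathbb G^n$ such that for every $\gamma$ $$\limsup_{R\in B(\gamma)(x),\ \operatorname{diam}R\to0}\frac1{|R|}\int_R f=\infty\quad\text{for almost every }x\in\mathbb G^n.$$ Theorem.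 Let $B$ be a translation invariant differentiation basis in $\mathbb R^n$ for which $\Phi_B$ is non-regular, i.e. $\limsup_{h\to\infty}\Phi_B(h)/h=\infty$. Let $\psi:[0,\infty)\to[0,\infty)$ be convex and increasing (in the wide sense) with $\psi(0)=0$ and $\psi(t)\to\infty$ as $t\to\infty$; suppose that $\psi$ satisfies the $\Delta_2$-condition at infinity (there are $c,\tau>0$ with $\psi(2t)\le c\,\psi(t)$ for all $t>\tau$) and that $\lim_{h\to\infty}\psi(h)/\Phi_B(h)=0$. Let $\psi(L)(\mathbb G^n)$ be the Orlicz space of all measurable $f:\mathbb R^n\to\mathbb R$ vanishing outside $\mathbb G^n$ with $\int\psi(|f|)<\infty$, with the Luxemburg norm $\|f\|=\inf\{a>0:\int\psi(|f|/a)\le1\}$. Then $\psi(L)(\mathbb G^n)\setminus S_{\Delta(B)}$ is of the first category in $\psi(L)(\mathbb G^n)$. -/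

import Mathlib

open MeasureTheory Filter Set Topology
open scoped ENNReal

/-- The Euclidean space `ℝⁿ`. -/
abbrev EucSp (n : ℕ) : Type := EuclideanSpace ℝ (Fin n)

/-- The open unit cube `𝔾ⁿ = (0,1)ⁿ`. -/
def unitCube (n : ℕ) : Set (EucSp n) := {x | ∀ i, x i ∈ Ioo (0 : ℝ) 1}

/-- A differentiation basis in `ℝⁿ`: to every point `x` a family of bounded (Lebesgue) measurable
sets of positive measure containing `x`, with a sequence of diameters tending to `0`.
(`NullMeasurableSet` for `volume` is Lebesgue measurability.) -/
structure DiffBasis (n : ℕ) where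
  sets : EucSp n → Set (Set (EucSp n))
  isBounded : ∀ x, ∀ R ∈ sets x, Bornology.IsBounded R
  measurable : ∀ x, ∀ R ∈ sets x, NullMeasurableSet R volume
  measure_pos : ∀ x, ∀ R ∈ sets x, 0 < volume R
  mem : ∀ x, ∀ R ∈ sets x, x ∈ R
  exists_seq : ∀ x, ∃ R : ℕ → Set (EucSp n), (∀ k, R k ∈ sets x) ∧
    Tendsto (fun k => Metric.diam (R k)) atTop (𝓝 0)

/-- A rotation of `ℝⁿ`: a linear isometry of determinant one. -/
def IsRotation {n : ℕ} (γ : EucSp n ≃ₗᵢ[ℝ] EucSp n) : Prop :=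
  LinearMap.det (γ.toLinearEquiv : EucSp n →ₗ[ℝ] EucSp n) = 1

/-- The map `y ↦ x + γ (y - x)`. -/
noncomputable def rotateAt {n : ℕ} (γ : EucSp n ≃ₗᵢ[ℝ] EucSp n) (x y : EucSp n) : EucSp n := x + γ (y - x)

theorem isometry_rotateAt {n : ℕ} (γ : EucSp n ≃ₗᵢ[ℝ] EucSp n) (x : EucSp n) :
    Isometry (rotateAt γ x) := by
  refine Isometry.of_dist_eq fun a b => ?_
  simp [rotateAt]

theorem measurePreserving_rotateAt {n : ℕ} (γ : EucSp n ≃ₗᵢ[ℝ] EucSp n) (x : EucSp n) :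
    MeasurePreserving (rotateAt γ x) volume volume :=
  ((measurePreserving_add_left volume x).comp γ.measurePreserving).comp
    (measurePreserving_sub_right volume x)

theorem image_rotateAt {n : ℕ} (γ : EucSp n ≃ₗᵢ[ℝ] EucSp n) (x : EucSp n) (I : Set (EucSp n)) :
    rotateAt γ x '' I = rotateAt γ.symm x ⁻¹' I :=
  congrFun (image_eq_preimage_of_inverse (f := rotateAt γ x) (g := rotateAt γ.symm x)
    (fun a => by simp [rotateAt]) (fun a => by simp [rotateAt])) I

namespace DiffBasis

variable {n : ℕ}

/-- `B(x) = {x + I : I ∈ B(0)}` for all `x`. -/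
def IsTranslationInvariant (B : DiffBasis n) : Prop :=
  ∀ x, B.sets x = {R | ∃ I ∈ B.sets 0, R = (fun y => x + y) '' I}

/-- The `γ`-rotated basis `B(γ)(x) = {x + γ(I - x) : I ∈ B(x)}`. -/
noncomputable def rotate (B : DiffBasis n) (γ : EucSp n ≃ₗᵢ[ℝ] EucSp n) : DiffBasis n where
  sets x := {R | ∃ I ∈ B.sets x, R = rotateAt γ x '' I}
  isBounded := by
    rintro x _ ⟨I, hI, rfl⟩
    exact (isometry_rotateAt γ x).lipschitz.isBounded_image (B.isBounded x I hI)
  measurable := by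
    rintro x _ ⟨I, hI, rfl⟩
    rw [image_rotateAt]
    exact (B.measurable x I hI).preimage (measurePreserving_rotateAt γ.symm x).quasiMeasurePreserving
  measure_pos := by
    rintro x _ ⟨I, hI, rfl⟩
    rw [image_rotateAt, (measurePreserving_rotateAt γ.symm x).measure_preimage (B.measurable x I hI)]
    exact B.measure_pos x I hI
  mem := by
    rintro x _ ⟨I, hI, rfl⟩
    exact ⟨x, B.mem x I hI, by simp [rotateAt]⟩
  exists_seq := by
    intro x
    obtain ⟨R, hR, hlim⟩ := B.exists_seq x
    refine ⟨fun k => rotateAt γ x '' R k, fun k => ⟨R k, hR k, rfl⟩, ?_⟩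
    simpa only [(isometry_rotateAt γ x).diam_image] using hlim

/-- The family `Δ(B)` of all rotated bases `B(γ)`. -/
def rotations (B : DiffBasis n) : Set (DiffBasis n) :=
  {B' | ∃ γ : EucSp n ≃ₗᵢ[ℝ] EucSp n, IsRotation γ ∧ B' = B.rotate γ}

/-- The upper derivative of `∫ f` at `x` with respect to `B`: the upper limit, in the extended
reals, of the means of `f` over the sets `R ∈ B(x)` as `diam R → 0`. -/
noncomputable def upperDeriv (B : DiffBasis n) (f : EucSp n → ℝ) (x : EucSp n) : EReal :=
  ⨅ (δ : ℝ) (_ : 0 < δ), ⨆ (R : Set (EucSp n)) (_ : R ∈ B.sets x) (_ : Metric.diam R < δ),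
    (((volume.real R)⁻¹ * ∫ y in R, f y : ℝ) : EReal)

/-- The truncated maximal operator `M_B^{(r)}`. -/
noncomputable def truncMax (B : DiffBasis n) (r : ℝ) (f : EucSp n → ℝ) (x : EucSp n) : ℝ≥0∞ :=
  ⨆ (R : Set (EucSp n)) (_ : R ∈ B.sets x) (_ : Metric.diam R < r),
    (volume R)⁻¹ * ∫⁻ y in R, ‖f y‖ₑ

/-- `limsup_{r → 0+} |{M_B^{(tr)}(h χ_{V_r}) > 1}| / |V_r|`, with `V_r` the ball of radius `r`
centred at the origin. -/
noncomputable def PhiAux (B : DiffBasis n) (h t : ℝ) : ℝ≥0∞ :=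
  limsup (fun r : ℝ =>
    volume {x | 1 < B.truncMax (t * r) ((Metric.ball (0 : EucSp n) r).indicator fun _ => h) x} /
      volume (Metric.ball (0 : EucSp n) r)) (𝓝[>] 0)

/-- `Φ_B(h)`, the limit of the above as `t → ∞`; it may be infinite. -/
noncomputable def Phi (B : DiffBasis n) (h : ℝ) : ℝ≥0∞ := limUnder atTop (B.PhiAux h)

theorem monotone_PhiAux (B : DiffBasis n) (h : ℝ) : Monotone (B.PhiAux h) := by
  intro s t hst
  refine limsup_le_limsup ?_
  filter_upwards [self_mem_nhdsWithin] with r hr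
  refine ENNReal.div_le_div_right (measure_mono (ofPred_subset_ofPred.2 fun x hx =>
    lt_of_lt_of_le hx ?_)) _
  unfold truncMax
  refine iSup_mono fun R => iSup_mono fun _ => iSup_le fun hd => ?_
  exact le_iSup_of_le (hd.trans_le (mul_le_mul_of_nonneg_right hst (le_of_lt hr))) le_rfl

/-- The limit defining `Φ_B(h)` exists in `[0,∞]`. -/
theorem tendsto_PhiAux (B : DiffBasis n) (h : ℝ) :
    Tendsto (B.PhiAux h) atTop (𝓝 (B.Phi h)) :=
  tendsto_nhds_limUnder ⟨_, tendsto_atTop_iSup (B.monotone_PhiAux h)⟩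

end DiffBasis

/-- Non-regularity: `limsup_{t → ∞} Φ(t)/t = ∞`. -/
def NonRegular (Φ : ℝ → ℝ≥0∞) : Prop :=
  limsup (fun t : ℝ => Φ t / ENNReal.ofReal t) atTop = ⊤

/-- The class `S_Λ` of all `f ∈ L(𝔾ⁿ)` whose integral has upper derivative `∞` almost everywhere
on `𝔾ⁿ` with respect to every basis of the family `Λ`. -/
def classS {n : ℕ} (Λ : Set (DiffBasis n)) : Set (EucSp n → ℝ) :=
  {f | Integrable f volume ∧ {x | f x ≠ 0} ⊆ unitCube n ∧
    ∀ B ∈ Λ, ∀ᵐ x ∂(volume.restrict (unitCube n)), B.upperDeriv f x = ⊤}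

/-- The `Δ₂`-condition at infinity. -/
def DeltaTwoAtInfinity (ψ : ℝ → ℝ) : Prop :=
  ∃ c > 0, ∃ τ > 0, ∀ t > τ, ψ (2 * t) ≤ c * ψ t

/-- A finite Young function `ψ : [0,∞) → [0,∞)`: convex, increasing, `ψ(0) = 0`, `ψ(t) → ∞`.
Only the values on `[0,∞)` matter. -/
structure YoungFunction where
  toFun : ℝ → ℝ
  convexOn : ConvexOn ℝ (Ici 0) toFun
  monotoneOn : MonotoneOn toFun (Ici 0)
  map_zero : toFun 0 = 0
  tendsto_atTop : Tendsto toFun atTop atTop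

instance : CoeFun YoungFunction fun _ => ℝ → ℝ := ⟨YoungFunction.toFun⟩

namespace YoungFunction

variable {n : ℕ}

/-- `∫ ψ(|f|)`; since `ψ(0) = 0`, only the set `{f ≠ 0}` contributes. -/
noncomputable def modular (ψ : YoungFunction) (f : EucSp n → ℝ) : ℝ≥0∞ :=
  ∫⁻ x, ENNReal.ofReal (ψ |f x|)

/-- The Luxemburg norm `inf {a > 0 : ∫ ψ(|f|/a) ≤ 1}`. -/
noncomputable def luxNorm (ψ : YoungFunction) (f : EucSp n → ℝ) : ℝ :=
  sInf {a : ℝ | 0 < a ∧ ψ.modular (fun x => f x / a) ≤ 1}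

theorem nonneg (ψ : YoungFunction) {t : ℝ} (ht : 0 ≤ t) : 0 ≤ ψ t := by
  simpa [ψ.map_zero] using ψ.monotoneOn (mem_Ici.2 le_rfl) ht ht

theorem aemeasurable_comp (ψ : YoungFunction) {f : EucSp n → ℝ} (hf : AEMeasurable f volume) :
    AEMeasurable (fun x => ENNReal.ofReal (ψ |f x|)) volume := by
  have hm : Monotone fun t : ℝ => ψ (max 0 t) := fun a b hab =>
    ψ.monotoneOn (mem_Ici.2 (le_max_left _ _)) (mem_Ici.2 (le_max_left _ _)) (max_le_max le_rfl hab)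
  have := (hm.measurable.comp_aemeasurable (measurable_norm.comp_aemeasurable hf)).ennreal_ofReal
  simpa [Function.comp_def] using this

theorem map_combo_le (ψ : YoungFunction) {a b s t u : ℝ} (ha : 0 ≤ a) (hb : 0 ≤ b)
    (hab : a + b = 1) (hs : 0 ≤ s) (ht : 0 ≤ t) (hu : 0 ≤ u) (h : u ≤ a * s + b * t) :
    ψ u ≤ a * ψ s + b * ψ t :=
  (ψ.monotoneOn hu (hu.trans h) h).trans (ψ.convexOn.2 hs ht ha hb hab)

theorem modular_le (ψ : YoungFunction) {a b : ℝ} (ha : 0 ≤ a) (hb : 0 ≤ b) (hab : a + b = 1)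
    {f g k : EucSp n → ℝ} (hf : AEMeasurable f volume)
    (h : ∀ x, |k x| ≤ a * |f x| + b * |g x|) :
    ψ.modular k ≤ ENNReal.ofReal a * ψ.modular f + ENNReal.ofReal b * ψ.modular g := by
  unfold modular
  rw [← lintegral_const_mul' _ _ ENNReal.ofReal_ne_top,
    ← lintegral_const_mul' _ _ ENNReal.ofReal_ne_top,
    ← lintegral_add_left' ((ψ.aemeasurable_comp hf).const_mul _)]
  refine lintegral_mono fun x => ?_
  rw [← ENNReal.ofReal_mul ha, ← ENNReal.ofReal_mul hb,
    ← ENNReal.ofReal_add (mul_nonneg ha (ψ.nonneg (abs_nonneg _)))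
      (mul_nonneg hb (ψ.nonneg (abs_nonneg _)))]
  exact ENNReal.ofReal_le_ofReal
    (ψ.map_combo_le ha hb hab (abs_nonneg _) (abs_nonneg _) (abs_nonneg _) (h x))

theorem modular_zero (ψ : YoungFunction) : ψ.modular (fun _ : EucSp n => 0) = 0 := by
  simp [modular, ψ.map_zero]

/-- The difference of two functions of finite modular has finite Luxemburg norm. -/
theorem luxNorm_set_nonempty (ψ : YoungFunction) {f g : EucSp n → ℝ}
    (hf : AEMeasurable f volume) (hg : AEMeasurable g volume)
    (hf' : ψ.modular f < ⊤) (hg' : ψ.modular g < ⊤) :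
    {a : ℝ | 0 < a ∧ ψ.modular (fun x => (f - g) x / a) ≤ 1}.Nonempty := by
  have h2 : ψ.modular (fun x => (f x - g x) / 2) < ⊤ := by
    refine lt_of_le_of_lt (ψ.modular_le (a := 1 / 2) (b := 1 / 2) (by norm_num) (by norm_num)
      (by norm_num) (f := f) (g := g) hf fun x => ?_)
      (ENNReal.add_lt_top.2 ⟨ENNReal.mul_lt_top ENNReal.ofReal_lt_top hf',
        ENNReal.mul_lt_top ENNReal.ofReal_lt_top hg'⟩)
    rw [abs_div, abs_two]
    linarith [abs_sub (f x) (g x)]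
  set C := ψ.modular (fun x => (f x - g x) / 2) with hC
  set N : ℝ := max 1 C.toReal with hN
  have hN1 : 1 ≤ N := le_max_left _ _
  have hN0 : 0 < N := by linarith
  refine ⟨2 * N, by positivity, ?_⟩
  have hinv : N⁻¹ ≤ 1 := inv_le_one_of_one_le₀ hN1
  refine (ψ.modular_le (a := N⁻¹) (b := 1 - N⁻¹) (by positivity) (by linarith) (by ring)
    (f := fun x => (f x - g x) / 2) (g := fun _ => 0) ((hf.sub hg).div_const 2) fun x => ?_).trans ?_
  · have : (f - g) x / (2 * N) = N⁻¹ * ((f x - g x) / 2) := by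
      simp only [Pi.sub_apply]; field_simp
    rw [this, abs_mul, abs_of_pos (inv_pos.2 hN0)]
    simp
  · rw [modular_zero, mul_zero, add_zero, ← hC, ← ENNReal.ofReal_toReal h2.ne,
      ← ENNReal.ofReal_mul (by positivity), ← ENNReal.ofReal_one]
    refine ENNReal.ofReal_le_ofReal ?_
    rw [inv_mul_le_iff₀ hN0, mul_one]
    exact le_max_right _ _

end YoungFunction

/-- The Orlicz class `ψ(L)(𝔾ⁿ)`: (Lebesgue) measurable functions on `ℝⁿ` vanishing outside `𝔾ⁿ`
with `∫ ψ(|f|) < ∞`. It is the whole Orlicz space when `ψ` satisfies `Δ₂` at infinity.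
Functions equal almost everywhere are at distance zero below instead of being identified, which
changes neither open sets nor category. -/
def OrliczSpace (ψ : YoungFunction) (n : ℕ) : Type :=
  {f : EucSp n → ℝ // AEMeasurable f volume ∧ {x | f x ≠ 0} ⊆ unitCube n ∧ ψ.modular f < ⊤}

/-- The (pseudo)metric `‖f - g‖` given by the Luxemburg norm. -/
noncomputable instance (ψ : YoungFunction) (n : ℕ) : PseudoMetricSpace (OrliczSpace ψ n) where
  dist f g := ψ.luxNorm (f.1 - g.1)
  dist_self f := by
    have : {a : ℝ | 0 < a ∧ ψ.modular (fun x => (f.1 - f.1) x / a) ≤ 1} = Ioi 0 := by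
      ext a
      simp [YoungFunction.modular_zero]
    rw [YoungFunction.luxNorm, this, csInf_Ioi]
  dist_comm f g := by
    have : ∀ a : ℝ, ψ.modular (fun x => (f.1 - g.1) x / a) =
        ψ.modular (fun x => (g.1 - f.1) x / a) := fun a => by
      simp only [YoungFunction.modular, Pi.sub_apply, abs_div, abs_sub_comm]
    simp only [YoungFunction.luxNorm, this]
  dist_triangle f g k := by
    have hne1 := ψ.luxNorm_set_nonempty f.2.1 g.2.1 f.2.2.2 g.2.2.2
    have hne2 := ψ.luxNorm_set_nonempty g.2.1 k.2.1 g.2.2.2 k.2.2.2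
    have key : ∀ a ∈ {a : ℝ | 0 < a ∧ ψ.modular (fun x => (f.1 - g.1) x / a) ≤ 1},
        ∀ b ∈ {a : ℝ | 0 < a ∧ ψ.modular (fun x => (g.1 - k.1) x / a) ≤ 1},
        ψ.luxNorm (f.1 - k.1) ≤ a + b := by
      rintro a ⟨ha, ha'⟩ b ⟨hb, hb'⟩
      have hab : 0 < a + b := add_pos ha hb
      refine csInf_le ⟨0, fun c hc => hc.1.le⟩ ⟨hab, ?_⟩
      have hsum : a / (a + b) + b / (a + b) = 1 := by field_simp
      refine (ψ.modular_le (a := a / (a + b)) (b := b / (a + b)) (by positivity) (by positivity)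
        hsum (f := fun x => (f.1 - g.1) x / a) (g := fun x => (g.1 - k.1) x / b)
        ((f.2.1.sub g.2.1).div_const a) fun x => ?_).trans ?_
      · have e : (f.1 - k.1) x / (a + b) =
            a / (a + b) * ((f.1 - g.1) x / a) + b / (a + b) * ((g.1 - k.1) x / b) := by
          simp only [Pi.sub_apply]; field_simp; ring
        rw [e]
        refine (abs_add_le _ _).trans ?_
        rw [abs_mul, abs_mul, abs_of_pos (div_pos ha hab), abs_of_pos (div_pos hb hab)]
      · calc _ ≤ ENNReal.ofReal (a / (a + b)) * 1 + ENNReal.ofReal (b / (a + b)) * 1 := by gcongr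
          _ = 1 := by
            rw [mul_one, mul_one, ← ENNReal.ofReal_add (by positivity) (by positivity), hsum,
              ENNReal.ofReal_one]
    have h1 : ∀ a ∈ {a : ℝ | 0 < a ∧ ψ.modular (fun x => (f.1 - g.1) x / a) ≤ 1},
        ψ.luxNorm (f.1 - k.1) - a ≤ ψ.luxNorm (g.1 - k.1) := fun a ha =>
      le_csInf hne2 fun b hb => by linarith [key a ha b hb]
    have h2 : ψ.luxNorm (f.1 - k.1) - ψ.luxNorm (g.1 - k.1) ≤ ψ.luxNorm (f.1 - g.1) :=
      le_csInf hne1 fun a ha => by linarith [h1 a ha]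
    linarith

/-! The space is exhausted, up to a meagre set, by functions whose means over small sets of every
rotated basis are large on most of the cube: `largeMeans B ψ k` contains a dense open set for each
`k`, and a function in all of these sets lies in the class `S` (`mem_classS_of_forall_mem_largeMeans`).
All linear isometries are treated at once, not only rotations.

The core is `DiffBasis.exists_covering`. If `N < Φ_B(h)`, there are arbitrarily small balls `V_r` for
which the level set `E = {M_B(h χ_{V_r}) > 1}` has measure more than `N |V_r|`; the level set for the
basis `B(γ)` is `γ E`, because `V_r` is invariant under `γ`. The ball is put at the points of the
lattice `s r ℤⁿ`, with `s` independent of `r`. The balls then fill a fixed fraction `v` of space, and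
the translates of `γ E` at least the fraction `d = N v`. When `r` is small compared with the scale at which
the part `A γ` of the cube that is not yet covered is continuous under translation, the translates
of `γ E` also fill nearly the fraction `d` of `A γ`. That scale can be chosen independently of `γ`
(`UnifTransCont`), since rotating a set does not change the measure of its difference with a translate
by a vector of given length, except by rotating the vector. So finitely many layers, each at a much
smaller scale than the preceding ones, cover all but `ε` of the cube for all `γ` simultaneously, with
balls of total measure at most a constant depending on `ε` divided by `N`.

Because `ψ / Φ_B → 0` and `ψ` satisfies `Δ₂`, one can take `N` a large multiple of `ψ(h)`; then
`M h χ_U`, with `U` the union of the balls, has small Luxemburg norm for any prescribed `M`. Adding it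
to a bounded function gives large means near almost all points of the cube. Only sets `R` with `|R|`
above a fixed `η > 0` are used, so a perturbation that is small in norm, hence in `L¹`, changes these
means by at most `1`; this gives the open set. -/

/-! ### Families of sets with uniformly continuous translations -/

/-- A family of subsets of `ℝⁿ` is uniformly translation continuous if `|(A i - y) ∆ A i|` tends
to `0` as `y → 0`, uniformly in `i`. -/
def UnifTransCont {n : ℕ} {ι : Type*} (A : ι → Set (EucSp n)) : Prop :=
  ∀ ε : ℝ≥0∞, ε ≠ 0 → ∀ᶠ y in 𝓝 (0 : EucSp n),
    ∀ i, volume (symmDiff ((fun x => y + x) ⁻¹' A i) (A i)) ≤ ε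

theorem tendsto_measure_symmDiff_translate {n : ℕ} {F : Set (EucSp n)}
    (hF : NullMeasurableSet F volume) (hF' : volume F ≠ ⊤) (a : EucSp n) :
    Tendsto (fun y => volume (symmDiff ((fun x => y + x) ⁻¹' F) ((fun x => a + x) ⁻¹' F)))
      (𝓝 a) (𝓝 0) := by
  let f : EucSp n → C(EucSp n, EucSp n) := fun y => ⟨fun x => y + x, by fun_prop⟩
  have hf : Continuous f := ContinuousMap.continuous_of_continuous_uncurry _ (by
    change Continuous fun p : EucSp n × EucSp n => p.1 + p.2
    fun_prop)
  exact tendsto_measure_symmDiff_preimage_nhds_zero (f := f) (g := f a) (hf.tendsto a)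
    (.of_forall fun y => measurePreserving_add_left volume y)
    (measurePreserving_add_left volume a) hF hF'

namespace UnifTransCont

variable {n : ℕ} {ι : Type*} {A A' : ι → Set (EucSp n)}

theorem const {F : Set (EucSp n)} (hF : MeasurableSet F) (hF' : volume F ≠ ⊤) :
    UnifTransCont fun _ : ι => F := by
  intro ε hε
  have h := tendsto_measure_symmDiff_translate hF.nullMeasurableSet hF' (0 : EucSp n)
  filter_upwards [h.eventually (ge_mem_nhds (pos_iff_ne_zero.2 hε))] with y hy _
  simpa using hy

theorem union (hA : UnifTransCont A) (hA' : UnifTransCont A') :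
    UnifTransCont fun i => A i ∪ A' i := by
  intro ε hε
  have hε2 : ε / 2 ≠ 0 := by simpa using hε
  filter_upwards [hA _ hε2, hA' _ hε2] with y hy hy' i
  refine (measure_mono ?_).trans ((measure_union_le _ _).trans
    ((add_le_add (hy i) (hy' i)).trans_eq (ENNReal.add_halves ε)))
  intro x
  simp only [Set.mem_symmDiff, mem_union, mem_preimage]
  tauto

theorem diff (hA : UnifTransCont A) (hA' : UnifTransCont A') :
    UnifTransCont fun i => A i \ A' i := by
  intro ε hε
  have hε2 : ε / 2 ≠ 0 := by simpa using hε
  filter_upwards [hA _ hε2, hA' _ hε2] with y hy hy' i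
  refine (measure_mono ?_).trans ((measure_union_le _ _).trans
    ((add_le_add (hy i) (hy' i)).trans_eq (ENNReal.add_halves ε)))
  intro x
  simp only [Set.mem_symmDiff, mem_union, mem_preimage, Set.mem_sdiff]
  tauto

theorem biUnion {κ : Type*} (s : Finset κ) {D : κ → ι → Set (EucSp n)}
    (hD : ∀ p ∈ s, UnifTransCont (D p)) : UnifTransCont fun i => ⋃ p ∈ s, D p i := by
  classical
  induction s using Finset.induction_on with
  | empty => simpa using const (ι := ι) (n := n) MeasurableSet.empty (by simp)
  | insert p s _ ih =>
    simp only [Finset.set_biUnion_insert]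
    exact (hD p (Finset.mem_insert_self _ _)).union
      (ih fun q hq => hD q (Finset.mem_insert_of_mem hq))

/-- The images of one set under all linear isometries, moved to `p`: since `γ⁻¹` preserves norms,
one modulus of continuity serves for all `γ`. -/
theorem isometry_image {F : Set (EucSp n)} (hF : MeasurableSet F) (hF' : volume F ≠ ⊤)
    (p : EucSp n) :
    UnifTransCont fun γ : EucSp n ≃ₗᵢ[ℝ] EucSp n => (fun x => γ.symm (x - p)) ⁻¹' F := by
  intro ε hε
  obtain ⟨δ, hδ, hb⟩ := Metric.eventually_nhds_iff.1 (const (ι := Unit) hF hF' ε hε)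
  refine Metric.eventually_nhds_iff.2 ⟨δ, hδ, fun y hy γ => ?_⟩
  have hy' : dist (γ.symm y) 0 < δ := by simpa using hy
  have hmp : MeasurePreserving (fun x => γ.symm (x - p)) (volume : Measure (EucSp n)) volume :=
    γ.symm.measurePreserving.comp (measurePreserving_sub_right volume p)
  have e : symmDiff ((fun x => y + x) ⁻¹' ((fun x => γ.symm (x - p)) ⁻¹' F))
      ((fun x => γ.symm (x - p)) ⁻¹' F) = (fun x => γ.symm (x - p)) ⁻¹'
        symmDiff ((fun x => γ.symm y + x) ⁻¹' F) F := by
    ext x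
    simp only [Set.mem_symmDiff, mem_preimage, ← map_add, add_sub_assoc]
  rw [e, hmp.measure_preimage ((hF.preimage (measurable_const_add _)).symmDiff hF).nullMeasurableSet]
  exact hb hy' ()

end UnifTransCont

/-! ### Averaging over a lattice -/

section Averaging

variable {n : ℕ}

theorem lintegral_measure_inter_translate {A F : Set (EucSp n)} (hA : MeasurableSet A)
    (hF : MeasurableSet F) :
    ∫⁻ y, volume (A ∩ {x | x - y ∈ F}) = volume A * volume F := by
  have hS : MeasurableSet {z : EucSp n × EucSp n | z.2 ∈ A ∧ z.2 - z.1 ∈ F} :=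
    (measurable_snd hA).inter ((measurable_snd.sub measurable_fst) hF)
  have h1 := Measure.prod_apply (μ := (volume : Measure (EucSp n)))
    (ν := (volume : Measure (EucSp n))) hS
  have h2 := Measure.prod_apply_symm (μ := (volume : Measure (EucSp n)))
    (ν := (volume : Measure (EucSp n))) hS
  have h3 : ∀ x : EucSp n, volume ((fun y : EucSp n => (y, x)) ⁻¹'
      {z : EucSp n × EucSp n | z.2 ∈ A ∧ z.2 - z.1 ∈ F}) = A.indicator (fun _ => volume F) x := by
    intro x
    by_cases hx : x ∈ A
    · simp only [preimage_ofPred_eq, hx, true_and, indicator_of_mem]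
      exact (Measure.measurePreserving_sub_left volume x).measure_preimage hF.nullMeasurableSet
    · simp [hx]
  simp only [h3, lintegral_indicator hA, lintegral_const, Measure.restrict_apply MeasurableSet.univ,
    univ_inter] at h2
  rw [mul_comm, ← h2, h1]
  rfl

theorem measurable_measure_inter_translate {A F : Set (EucSp n)} (hA : MeasurableSet A)
    (hF : MeasurableSet F) : Measurable fun y => volume (A ∩ {x | x - y ∈ F}) := by
  have hS : MeasurableSet {z : EucSp n × EucSp n | z.2 ∈ A ∧ z.2 - z.1 ∈ F} :=
    (measurable_snd hA).inter ((measurable_snd.sub measurable_fst) hF)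
  exact measurable_measure_prodMk_left (ν := (volume : Measure (EucSp n))) hS

theorem lintegral_tsum_measure_inter_translate {L : Submodule ℤ (EucSp n)} [Countable L]
    {Q A F : Set (EucSp n)} (hQ : IsAddFundamentalDomain L Q (volume : Measure (EucSp n)))
    (hA : MeasurableSet A) (hF : MeasurableSet F) :
    ∫⁻ y in Q, ∑' l : L, volume (A ∩ {x | x - y - l ∈ F}) = volume A * volume F := by
  have : VAddInvariantMeasure L (EucSp n) volume :=
    ⟨fun l s _ => measure_preimage_add volume (l : EucSp n) s⟩
  rw [← lintegral_measure_inter_translate hA hF, hQ.lintegral_eq_tsum'', lintegral_tsum]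
  · refine tsum_congr fun l => lintegral_congr fun y => ?_
    simp only [Submodule.vadd_def, vadd_eq_add, sub_sub, add_comm y]
  · intro l
    have := (measurable_measure_inter_translate hA hF).comp (measurable_add_const (l : EucSp n))
    simpa only [Function.comp_def, sub_sub] using this.aemeasurable

theorem measure_inter_translate (A W : Set (EucSp n)) (y : EucSp n) :
    volume (A ∩ {x | x - y ∈ W}) = volume ((fun x => y + x) ⁻¹' A ∩ W) := by
  have h : (fun x => y + x) ⁻¹' (A ∩ {x | x - y ∈ W}) = (fun x => y + x) ⁻¹' A ∩ W := by
    ext x; simp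
  rw [← h, measure_preimage_add]

/-- A lattice union of pairwise disjoint translates of `F` meets `A` in at least the fraction
`|F| / |Q|` of `A`, up to the modulus of translation continuity of `A` at the scale of `Q`. -/
theorem mul_le_measure_inter_lattice {L : Submodule ℤ (EucSp n)} [Countable L]
    {Q A F : Set (EucSp n)} (hQ : IsAddFundamentalDomain L Q (volume : Measure (EucSp n)))
    (hA : MeasurableSet A) (hF : MeasurableSet F)
    (hd : Pairwise fun l l' : L => Disjoint {x : EucSp n | x - l ∈ F} {x | x - l' ∈ F}) {ω : ℝ≥0∞}
    (hω : ∀ y ∈ Q, volume (symmDiff ((fun x => y + x) ⁻¹' A) A) ≤ ω) :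
    volume A * volume F ≤ volume Q * (volume (A ∩ ⋃ l : L, {x | x - l ∈ F}) + ω) := by
  rw [← lintegral_tsum_measure_inter_translate hQ hA hF, mul_comm, ← setLIntegral_const]
  refine lintegral_mono_ae ((ae_restrict_iff'₀ hQ.nullMeasurableSet).2 (.of_forall fun y hy => ?_))
  have hm : ∀ l : L, MeasurableSet {x : EucSp n | x - y - l ∈ F} := fun l =>
    ((measurable_sub_const (l : EucSp n)).comp (measurable_sub_const y)) hF
  have hd' : Pairwise fun l l' : L => Disjoint (A ∩ {x : EucSp n | x - y - l ∈ F})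
      (A ∩ {x | x - y - l' ∈ F}) := fun l l' hl => Set.disjoint_left.2 fun x hx hx' =>
    Set.disjoint_left.1 (hd hl) (show x - y ∈ {z : EucSp n | z - l ∈ F} from hx.2) hx'.2
  rw [← measure_iUnion hd' fun l => hA.inter (hm l), ← inter_iUnion]
  have e : (⋃ l : L, {x : EucSp n | x - y - l ∈ F}) =
      {x | x - y ∈ ⋃ l : L, {x : EucSp n | x - l ∈ F}} := by ext; simp
  rw [e, measure_inter_translate]
  refine (measure_mono ?_).trans ((measure_union_le _ _).trans (add_le_add_right (hω y hy) _))
  intro x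
  simp only [Set.mem_symmDiff, mem_inter_iff, mem_union]
  tauto

/-- A lattice union of translates of `F` meets `A` in at most the fraction `|F| / |Q|` of `A`, up
to the modulus of translation continuity of `A` at the scale of `Q`. -/
theorem measure_inter_lattice_le {L : Submodule ℤ (EucSp n)} [Countable L]
    {Q A F : Set (EucSp n)} (hQ : IsAddFundamentalDomain L Q (volume : Measure (EucSp n)))
    (hA : MeasurableSet A) (hF : MeasurableSet F) {ω : ℝ≥0∞}
    (hω : ∀ y ∈ Q, volume (symmDiff ((fun x => y + x) ⁻¹' A) A) ≤ ω) :
    volume Q * volume (A ∩ ⋃ l : L, {x | x - l ∈ F}) ≤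
      volume A * volume F + volume Q * ω := by
  rw [← lintegral_tsum_measure_inter_translate hQ hA hF, mul_comm, mul_comm (volume Q),
    ← setLIntegral_const, ← setLIntegral_const, ← lintegral_add_right _ measurable_const]
  refine lintegral_mono_ae ((ae_restrict_iff'₀ hQ.nullMeasurableSet).2 (.of_forall fun y hy => ?_))
  have e : (⋃ l : L, {x : EucSp n | x - y - l ∈ F}) =
      {x | x - y ∈ ⋃ l : L, {x : EucSp n | x - l ∈ F}} := by ext; simp
  refine le_trans ?_ (add_le_add (measure_iUnion_le _) (hω y hy))
  rw [← inter_iUnion, e, measure_inter_translate]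
  refine (measure_mono ?_).trans (measure_union_le _ _)
  intro x
  simp only [Set.mem_symmDiff, mem_inter_iff, mem_union]
  tauto

end Averaging

/-! ### The cubic lattices -/

/-- The lattices `q ℤⁿ` in the form used for coverings: balls of radius `q / 2` are moved to
pairwise disjoint balls. -/
theorem exists_cubic_lattice {n : ℕ} {q : ℝ} (hq : 0 < q) :
    ∃ (L : Submodule ℤ (EucSp n)) (Q : Set (EucSp n)), Countable L ∧
      IsAddFundamentalDomain L Q (volume : Measure (EucSp n)) ∧
      volume Q = ENNReal.ofReal (q ^ n) ∧ (∀ x ∈ Q, ‖x‖ ≤ n * q) ∧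
      (∀ s : Set (EucSp n), Bornology.IsBounded s → (s ∩ (L : Set (EucSp n))).Finite) ∧
      ∀ l ∈ L, l ≠ 0 → q ≤ ‖l‖ := by
  set o := EuclideanSpace.basisFun (Fin n) ℝ with ho
  set b := o.toBasis.unitsSMul (fun _ => Units.mk0 q hq.ne') with hb
  have hbi : ∀ i, b i = q • o i := fun i => by simp [hb, Module.Basis.unitsSMul_apply, Units.smul_def]
  refine ⟨Submodule.span ℤ (range b), ZSpan.fundamentalDomain b, inferInstance,
    ZSpan.isAddFundamentalDomain b volume, ?_, ?_, fun s hs => ZSpan.setFinite_inter b hs, ?_⟩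
  · rw [ZSpan.measure_fundamentalDomain b volume o.toBasis, hb, Module.Basis.det_unitsSMul_self,
      measure_congr (ZSpan.fundamentalDomain_ae_parallelepiped o.toBasis volume)]
    rw [OrthonormalBasis.coe_toBasis, o.volume_parallelepiped]
    simp [abs_of_pos hq]
  · intro x hx
    have h := ZSpan.norm_fract_le b x
    rw [ZSpan.fract_eq_self.2 hx] at h
    refine h.trans_eq ?_
    simp [hbi, norm_smul, abs_of_pos hq]
  · intro l hl hl0
    rw [Module.Basis.mem_span_iff_repr_mem] at hl
    obtain ⟨i, hi⟩ : ∃ i, b.repr l i ≠ 0 := by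
      by_contra! h
      exact hl0 (b.repr.map_eq_zero_iff.1 (Finsupp.ext h))
    obtain ⟨z, hz⟩ := hl i
    have hz0 : z ≠ 0 := by
      rintro rfl
      exact hi (by rw [← hz]; simp)
    have h1 : l i = q * z := by
      have h := congrArg (EuclideanSpace.proj i : EucSp n →L[ℝ] ℝ) (b.sum_repr l)
      simp only [hbi, map_sum, map_smul, smul_eq_mul] at h
      change _ = l i at h
      rw [← h, Finset.sum_eq_single i]
      · rw [← hz]; simp [ho]; ring
      · intro j _ hj
        simp [ho, hj]
      · simp
    have h2 : (1 : ℝ) ≤ |(z : ℝ)| := by exact_mod_cast Int.one_le_abs hz0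
    calc q ≤ q * |(z : ℝ)| := le_mul_of_one_le_right hq.le h2
      _ = ‖l i‖ := by rw [h1, Real.norm_eq_abs, abs_mul, abs_of_pos hq]
      _ ≤ ‖l‖ := PiLp.norm_apply_le l i

/-! ### Level sets of the maximal operator -/

namespace DiffBasis

variable {n : ℕ}

/-- The points `x` for which some `I ∈ B(0)` with `diam I < ρ` and `|I| > η` has mean of
`h χ_{V_r}` over `x + I` greater than `1`. The translate is moved to the ball:
`|(x + I) ∩ V_r| = |I ∩ (V_r - x)|`. -/
def reach (B : DiffBasis n) (h ρ : ℝ) (η : ℝ≥0∞) (r : ℝ) : Set (EucSp n) :=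
  {x | ∃ I ∈ B.sets 0, Metric.diam I < ρ ∧ η < volume I ∧
    volume I < ENNReal.ofReal h * volume (I ∩ Metric.ball (-x) r)}

theorem isOpen_setOf_lt_mul_measure_inter_ball (I : Set (EucSp n)) (c C : ℝ≥0∞) (hC : C ≠ ⊤)
    (r : ℝ) : IsOpen {x | c < C * volume (I ∩ Metric.ball (-x) r)} := by
  rw [isOpen_iff_mem_nhds]
  intro x hx
  have h := (tendsto_measure_symmDiff_translate (F := Metric.ball (0 : EucSp n) r)
    measurableSet_ball.nullMeasurableSet measure_ball_lt_top.ne x)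
  have hb : ∀ y : EucSp n, (fun z => y + z) ⁻¹' Metric.ball (0 : EucSp n) r =
      Metric.ball (-y) r := fun y => by
    ext z
    simp [dist_eq_norm, add_comm]
  simp only [hb] at h
  set a := volume (I ∩ Metric.ball (-x) r) with ha
  have hafin : a ≠ ⊤ := ((measure_mono inter_subset_right).trans_lt measure_ball_lt_top).ne
  have hlim : Tendsto (fun y => C * (a - volume (symmDiff (Metric.ball (-y) r) (Metric.ball (-x) r))))
      (𝓝 x) (𝓝 (C * (a - 0))) :=
    ENNReal.Tendsto.const_mul (ENNReal.Tendsto.sub tendsto_const_nhds h (Or.inl hafin)) (Or.inr hC)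
  rw [tsub_zero] at hlim
  filter_upwards [hlim.eventually (lt_mem_nhds hx)] with y hy
  refine lt_of_lt_of_le hy (mul_le_mul_right ?_ _)
  rw [tsub_le_iff_right]
  refine (measure_mono ?_).trans (measure_union_le _ _)
  intro z
  simp only [Set.mem_symmDiff, mem_inter_iff, mem_union]
  tauto

theorem isOpen_reach (B : DiffBasis n) (h ρ : ℝ) (η : ℝ≥0∞) (r : ℝ) : IsOpen (B.reach h ρ η r) := by
  have : B.reach h ρ η r = ⋃ (I ∈ B.sets 0) (_ : Metric.diam I < ρ) (_ : η < volume I),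
      {x | volume I < ENNReal.ofReal h * volume (I ∩ Metric.ball (-x) r)} := by
    ext x
    simp only [reach, mem_iUnion, exists_prop, mem_ofPred_eq]
  rw [this]
  exact isOpen_iUnion fun I => isOpen_iUnion fun _ => isOpen_iUnion fun _ => isOpen_iUnion fun _ =>
    isOpen_setOf_lt_mul_measure_inter_ball I _ _ ENNReal.ofReal_ne_top r

theorem reach_subset_ball (B : DiffBasis n) (h ρ : ℝ) (η : ℝ≥0∞) (r : ℝ) :
    B.reach h ρ η r ⊆ Metric.ball 0 (ρ + r) := by
  rintro x ⟨I, hI, hd, -, hv⟩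
  have hne : volume (I ∩ Metric.ball (-x) r) ≠ 0 := fun h0 => by simp [h0] at hv
  obtain ⟨z, hzI, hz⟩ := nonempty_of_measure_ne_zero hne
  have h1 := Metric.dist_le_diam_of_mem (B.isBounded 0 I hI) hzI (B.mem 0 I hI)
  rw [Metric.mem_ball, dist_eq_norm, sub_neg_eq_add] at hz
  rw [dist_zero_right] at h1
  rw [mem_ball_zero_iff]
  calc ‖x‖ = ‖(z + x) - z‖ := by rw [add_sub_cancel_left]
    _ ≤ ‖z + x‖ + ‖z‖ := norm_sub_le _ _
    _ < ρ + r := by linarith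

theorem reach_anti (B : DiffBasis n) (h ρ r : ℝ) : Antitone fun η => B.reach h ρ η r :=
  fun _ _ hη _ ⟨I, hI, hd, hv, hv'⟩ => ⟨I, hI, hd, hη.trans_lt hv, hv'⟩

theorem setOf_one_lt_truncMax_subset {B : DiffBasis n} (hB : B.IsTranslationInvariant) {h : ℝ}
    (hh : 0 ≤ h) (ρ r : ℝ) :
    {x | 1 < B.truncMax ρ ((Metric.ball (0 : EucSp n) r).indicator fun _ => h) x} ⊆
      ⋃ j : ℕ, B.reach h ρ ((j : ℝ≥0∞) + 1)⁻¹ r := by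
  intro x hx
  simp only [mem_ofPred_eq, truncMax, lt_iSup_iff] at hx
  obtain ⟨R, hR, hd, hm⟩ := hx
  rw [hB x] at hR
  obtain ⟨I, hI, rfl⟩ := hR
  have hiso : Isometry fun y : EucSp n => x + y := isometry_add_left x
  rw [hiso.diam_image] at hd
  have himg : ∀ s : Set (EucSp n), volume ((fun y => x + y) '' s) = volume s := fun s =>
    by rw [image_add_left, measure_preimage_add]
  have hI0 := (B.measure_pos 0 I hI).ne'
  have hIt := (B.isBounded 0 I hI).measure_lt_top (μ := volume).ne
  rw [himg] at hm
  have hint : ∫⁻ y in (fun y => x + y) '' I, ‖(Metric.ball (0 : EucSp n) r).indicator (fun _ => h) y‖ₑ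
      = ENNReal.ofReal h * volume (I ∩ Metric.ball (-x) r) := by
    simp only [enorm_indicator_eq_indicator_enorm]
    rw [lintegral_indicator measurableSet_ball, setLIntegral_const, Real.enorm_eq_ofReal hh,
      Measure.restrict_apply measurableSet_ball, ← himg (I ∩ _), image_inter hiso.injective]
    congr 2
    rw [inter_comm]
    congr 1
    ext z
    simp [dist_eq_norm]
  rw [hint] at hm
  have hv : volume I < ENNReal.ofReal h * volume (I ∩ Metric.ball (-x) r) := by
    rw [mul_comm, ← div_eq_mul_inv, ENNReal.lt_div_iff_mul_lt (Or.inl hI0) (Or.inl hIt), one_mul] at hm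
    exact hm
  obtain ⟨j, hj⟩ := ENNReal.exists_inv_nat_lt hI0
  refine mem_iUnion.2 ⟨j, I, hI, hd, lt_of_le_of_lt ?_ hj, hv⟩
  exact ENNReal.inv_le_inv.2 le_self_add

theorem exists_lt_measure_reach {B : DiffBasis n} (hB : B.IsTranslationInvariant) {h : ℝ}
    (hh : 0 ≤ h) {ρ r : ℝ} {a : ℝ≥0∞}
    (ha : a < volume {x | 1 < B.truncMax ρ ((Metric.ball (0 : EucSp n) r).indicator fun _ => h) x}) :
    ∃ η : ℝ≥0∞, 0 < η ∧ a < volume (B.reach h ρ η r) := by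
  have hmono : Monotone fun j : ℕ => B.reach h ρ ((j : ℝ≥0∞) + 1)⁻¹ r := fun i j hij =>
    B.reach_anti h ρ r (ENNReal.inv_le_inv.2 (by gcongr))
  have h1 := ha.trans_le (measure_mono (setOf_one_lt_truncMax_subset hB hh ρ r))
  rw [hmono.measure_iUnion, lt_iSup_iff] at h1
  obtain ⟨j, hj⟩ := h1
  exact ⟨_, by simp, hj⟩

/-- The meaning of `N < Φ_B(h)`: for some `t` there are arbitrarily small radii `r` for which the
level set inside the `(t + 1) r`-ball has measure greater than `N |V_r|`. -/
theorem exists_reach_of_lt_Phi {B : DiffBasis n} (hB : B.IsTranslationInvariant) {h : ℝ}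
    (hh : 0 ≤ h) {N : ℝ≥0∞} (hN : N < B.Phi h) :
    ∃ t : ℝ, 0 < t ∧ ∀ δ > 0, ∃ r, 0 < r ∧ r < δ ∧ ∃ η : ℝ≥0∞, 0 < η ∧
      N * volume (Metric.ball (0 : EucSp n) r) < volume (B.reach h (t * r) η r) := by
  obtain ⟨t, ht, ht0⟩ :=
    (((B.tendsto_PhiAux h).eventually (lt_mem_nhds hN)).and (eventually_gt_atTop 0)).exists
  refine ⟨t, ht0, fun δ hδ => ?_⟩
  have hf := frequently_lt_of_lt_limsup (by isBoundedDefault) ht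
  obtain ⟨r, hr, hr0, hrδ⟩ := (hf.and_eventually (Ioo_mem_nhdsGT hδ)).exists
  refine ⟨r, hr0, hrδ, exists_lt_measure_reach hB hh ?_⟩
  exact (ENNReal.lt_div_iff_mul_lt (Or.inl (Metric.measure_ball_pos _ _ hr0).ne')
    (Or.inl measure_ball_lt_top.ne)).1 hr

end DiffBasis

/-! ### Covering by rotated level sets -/

theorem volume_image_add_isometry {n : ℕ} (γ : EucSp n ≃ₗᵢ[ℝ] EucSp n) (x : EucSp n)
    (s : Set (EucSp n)) : volume ((fun y => x + γ y) '' s) = volume s := by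
  have h1 : (fun y => x + γ y) '' s = (fun y => x + y) '' (γ '' s) := by
    rw [image_image]
  have h2 : γ '' s = γ.symm.toMeasurableEquiv ⁻¹' s := by
    ext y
    constructor
    · rintro ⟨z, hz, rfl⟩
      simpa using hz
    · intro hy
      exact ⟨γ.symm y, hy, by simp⟩
  rw [h1, image_add_left, measure_preimage_add, h2]
  exact MeasurePreserving.measure_preimage_equiv (f := γ.symm.toMeasurableEquiv)
    γ.symm.measurePreserving s

namespace DiffBasis

variable {n : ℕ}

/-- `x` is an `(η, δ)`-good point for `U`: for some `I ∈ B(0)` with `diam I < δ` and `|I| > η`, the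
mean of `h χ_U` over `x + γ I` is greater than `1`. -/
def Good (B : DiffBasis n) (h : ℝ) (U : Set (EucSp n)) (η : ℝ≥0∞) (δ : ℝ)
    (γ : EucSp n ≃ₗᵢ[ℝ] EucSp n) (x : EucSp n) : Prop :=
  ∃ I ∈ B.sets 0, Metric.diam I < δ ∧ η < volume I ∧
    volume I < ENNReal.ofReal h * volume ((fun y => x + γ y) '' I ∩ U)

theorem Good.mono {B : DiffBasis n} {h : ℝ} {U U' : Set (EucSp n)} {η η' : ℝ≥0∞} {δ : ℝ}
    {γ : EucSp n ≃ₗᵢ[ℝ] EucSp n} {x : EucSp n} (hx : B.Good h U η δ γ x) (hU : U ⊆ U')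
    (hη : η' ≤ η) : B.Good h U' η' δ γ x := by
  obtain ⟨I, hI, hd, hv, hv'⟩ := hx
  exact ⟨I, hI, hd, hη.trans_lt hv, hv'.trans_le (by gcongr)⟩

/-- One layer of the covering: balls of a small radius `r` with centres in a lattice of mesh `s r`.
They occupy the fraction `v` of `G`, while for every `γ` the corresponding level sets fill at least
the fraction `N v` of `A γ`. The numbers `s` and `v` do not depend on `r`. -/
theorem exists_layer (hn : n ≠ 0) {B : DiffBasis n} (hB : B.IsTranslationInvariant) {h : ℝ}
    (hh : 0 ≤ h) {N : ℝ} (hN0 : 0 < N) (hN : ENNReal.ofReal N < B.Phi h)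
    {G : Set (EucSp n)} (hG : MeasurableSet G) (hGb : Bornology.IsBounded G) :
    ∃ v : ℝ, 0 < v ∧ N * v ≤ 1 ∧ ∀ A : (EucSp n ≃ₗᵢ[ℝ] EucSp n) → Set (EucSp n),
      UnifTransCont A → (∀ γ, MeasurableSet (A γ)) → (∀ γ, A γ ⊆ G) → ∀ ω : ℝ≥0∞, ω ≠ 0 →
      ∀ δ > 0, ∃ (U : Set (EucSp n)) (η : ℝ≥0∞) (W : (EucSp n ≃ₗᵢ[ℝ] EucSp n) → Set (EucSp n)),
        MeasurableSet U ∧ 0 < η ∧ UnifTransCont W ∧ (∀ γ, MeasurableSet (W γ)) ∧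
        volume (G ∩ U) ≤ volume G * ENNReal.ofReal v + ω ∧
        (∀ γ, volume (A γ) * ENNReal.ofReal (N * v) ≤ volume (A γ ∩ W γ) + ω) ∧
        ∀ γ, ∀ x ∈ W γ, B.Good h U η δ γ x := by
  have : Nonempty (Fin n) := Fin.pos_iff_nonempty.1 (Nat.pos_of_ne_zero hn)
  obtain ⟨t, ht, hr⟩ := exists_reach_of_lt_Phi hB hh hN
  set V : ℝ := volume.real (Metric.ball (0 : EucSp n) 1) with hV
  have hV0 : 0 < V := ENNReal.toReal_pos (Metric.measure_ball_pos _ _ one_pos).ne'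
    measure_ball_lt_top.ne
  -- The term `N * V` in the mesh makes `N * v ≤ 1`.
  set s : ℝ := 2 * (t + 1) + N * V + 1 with hs
  have hNV : 0 < N * V := mul_pos hN0 hV0
  have hs1 : 1 ≤ s := by linarith
  have hs0 : 0 < s := by linarith
  refine ⟨V / s ^ n, by positivity, ?_, ?_⟩
  · rw [mul_div_assoc', div_le_one (by positivity)]
    calc N * V ≤ s := by linarith
      _ ≤ s ^ n := le_self_pow₀ hs1 hn
  intro A hA hAm hAG ω hω δ hδ
  obtain ⟨δ₁, hδ₁, hδA⟩ := Metric.eventually_nhds_iff.1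
    ((hA ω hω).and (UnifTransCont.const (ι := Unit) hG hGb.measure_lt_top.ne ω hω))
  obtain ⟨ρ, hρ⟩ := hGb.subset_ball (0 : EucSp n)
  obtain ⟨r, hr0, hrlt, η, hη, hvol⟩ := hr (min (δ₁ / (n * s + 1)) (min (δ / t) (1 / (t + 1))))
    (by positivity)
  rw [lt_min_iff, lt_min_iff, lt_div_iff₀ (by positivity), lt_div_iff₀ ht,
    lt_div_iff₀ (by positivity)] at hrlt
  obtain ⟨hr1, hr2, hr3⟩ := hrlt
  have hq : 0 < s * r := mul_pos hs0 hr0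
  obtain ⟨L, Q, hLc, hQ, hQv, hQn, hLf, hLd⟩ := exists_cubic_lattice (n := n) hq
  set F := B.reach h (t * r) η r with hF
  have hFm : MeasurableSet F := (B.isOpen_reach h (t * r) η r).measurableSet
  have hFb : F ⊆ Metric.ball 0 (t * r + r) := B.reach_subset_ball h (t * r) η r
  have hFtop : volume F ≠ ⊤ := ((measure_mono hFb).trans_lt measure_ball_lt_top).ne
  have hball : volume (Metric.ball (0 : EucSp n) r) = ENNReal.ofReal (r ^ n * V) := by
    rw [Measure.addHaar_ball _ _ hr0.le, finrank_euclideanSpace_fin,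
      ENNReal.ofReal_mul (by positivity), hV, ofReal_measureReal measure_ball_lt_top.ne]
  have hQ0 : volume Q ≠ 0 := by rw [hQv]; simpa using pow_pos hq n
  have hQt : volume Q ≠ ⊤ := by rw [hQv]; exact ENNReal.ofReal_ne_top
  have hcell : volume (Metric.ball (0 : EucSp n) r) = volume Q * ENNReal.ofReal (V / s ^ n) := by
    rw [hball, hQv, ← ENNReal.ofReal_mul (by positivity)]
    congr 1
    rw [mul_pow]
    field_simp
  have hω' : ∀ y ∈ Q, dist y 0 < δ₁ := fun y hy => by
    rw [dist_zero_right]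
    refine (hQn y hy).trans_lt ?_
    nlinarith
  -- Only the lattice points near `G` matter, and there are finitely many of them.
  set P := (hLf (Metric.ball 0 (ρ + 1)) Metric.isBounded_ball).toFinset with hP
  have hmemP : ∀ p, p ∈ P ↔ p ∈ Metric.ball (0 : EucSp n) (ρ + 1) ∧ p ∈ L := fun p => by
    simp [hP]
  refine ⟨⋃ p ∈ P, {x | x - p ∈ Metric.ball (0 : EucSp n) r}, η,
    fun γ => ⋃ p ∈ P, (fun x => γ.symm (x - p)) ⁻¹' F, ?_, hη, ?_, ?_, ?_, ?_, ?_⟩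
  · exact Finset.measurableSet_biUnion _ fun p _ => (measurable_sub_const p) measurableSet_ball
  · exact UnifTransCont.biUnion P fun p _ => UnifTransCont.isometry_image hFm hFtop p
  · exact fun γ => Finset.measurableSet_biUnion _ fun p _ =>
      (γ.symm.continuous.measurable.comp (measurable_sub_const p)) hFm
  · have h1 := measure_inter_lattice_le hQ hG (F := Metric.ball (0 : EucSp n) r)
      measurableSet_ball fun y hy => (hδA (hω' y hy)).2 ()
    rw [hcell, mul_left_comm, ← mul_add] at h1
    refine (measure_mono (inter_subset_inter_right _ ?_)).trans
      ((ENNReal.mul_le_mul_iff_right hQ0 hQt).1 h1)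
    exact iUnion₂_subset fun p hp => subset_iUnion_of_subset ⟨p, ((hmemP p).1 hp).2⟩ subset_rfl
  · intro γ
    have hFγ : MeasurableSet (γ.symm ⁻¹' F) := γ.symm.continuous.measurable hFm
    have hvγ : volume (γ.symm ⁻¹' F) = volume F :=
      γ.symm.measurePreserving.measure_preimage hFm.nullMeasurableSet
    have hnorm : ∀ x ∈ γ.symm ⁻¹' F, ‖x‖ < t * r + r := fun x hx => by
      simpa using hFb hx
    have hd : Pairwise fun l l' : L => Disjoint {x : EucSp n | x - l ∈ γ.symm ⁻¹' F}
        {x | x - l' ∈ γ.symm ⁻¹' F} := by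
      intro l l' hl
      refine Set.disjoint_left.2 fun x hx hx' => ?_
      have h1 := hnorm _ hx
      have h2 := hnorm _ hx'
      have h3 := hLd ((l : EucSp n) - l') (sub_mem l.2 l'.2)
        (sub_ne_zero.2 fun e => hl (Subtype.ext e))
      have h4 : ‖(l : EucSp n) - l'‖ ≤ ‖x - l'‖ + ‖x - l‖ := by
        rw [← sub_sub_sub_cancel_left (l' : EucSp n) l x]
        exact norm_sub_le _ _
      nlinarith
    have h1 := mul_le_measure_inter_lattice hQ (hAm γ) hFγ hd fun y hy => (hδA (hω' y hy)).1 γ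
    rw [hvγ] at h1
    have h2 : volume Q * (volume (A γ) * ENNReal.ofReal (N * (V / s ^ n))) ≤
        volume (A γ) * volume F := by
      rw [ENNReal.ofReal_mul hN0.le]
      calc _ = volume (A γ) *
            (ENNReal.ofReal N * (volume Q * ENNReal.ofReal (V / s ^ n))) := by ring
        _ ≤ _ := by rw [← hcell]; gcongr
    refine ((ENNReal.mul_le_mul_iff_right hQ0 hQt).1 (h2.trans h1)).trans
      (add_le_add (measure_mono ?_) le_rfl)
    rintro x ⟨hxA, hx⟩
    obtain ⟨l, hl⟩ := mem_iUnion.1 hx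
    refine ⟨hxA, mem_iUnion₂.2 ⟨l, (hmemP l).2 ⟨?_, l.2⟩, hl⟩⟩
    have h3 := hnorm _ hl
    have h4 : ‖x‖ < ρ := by simpa using hρ (hAG γ hxA)
    rw [mem_ball_zero_iff]
    calc ‖(l : EucSp n)‖ = ‖x - (x - l)‖ := by rw [sub_sub_cancel]
      _ ≤ ‖x‖ + ‖x - l‖ := norm_sub_le _ _
      _ < ρ + 1 := by nlinarith
  · intro γ x hx
    obtain ⟨p, hp, I, hI, hd, hv, hv'⟩ := mem_iUnion₂.1 hx
    refine ⟨I, hI, by nlinarith, hv, hv'.trans_le ?_⟩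
    rw [← volume_image_add_isometry γ x (I ∩ _)]
    gcongr
    rintro _ ⟨y, ⟨hy, hyb⟩, rfl⟩
    refine ⟨⟨y, hy, rfl⟩, mem_iUnion₂.2 ⟨p, hp, ?_⟩⟩
    rw [Metric.mem_ball, dist_eq_norm, sub_neg_eq_add] at hyb
    rw [mem_ofPred_eq, mem_ball_zero_iff]
    have : x + γ y - p = γ (y + γ.symm (x - p)) := by
      rw [map_add, γ.apply_symm_apply]; abel
    rwa [this, γ.norm_map]

/-- Iterating the layers: as long as the uncovered part `A γ` of `K` has measure more than `ε`, a
layer of density `v` removes at least `d ε / 2` of it, where `d = N v`. So `2 / (d ε)` layers, rounded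
up, suffice, and their balls occupy only `O(v / (d ε)) = O(1 / (N ε))` of `G`.
For every linear isometry `γ`, all of `K` but a set of measure `ε` consists of good points,
with the same `U` and `η` for all `γ`. -/
theorem exists_covering (hn : n ≠ 0) {B : DiffBasis n} (hB : B.IsTranslationInvariant) {h : ℝ}
    (hh : 0 ≤ h) {N : ℝ} (hN0 : 0 < N) (hN : ENNReal.ofReal N < B.Phi h)
    {G K : Set (EucSp n)} (hG : MeasurableSet G) (hGb : Bornology.IsBounded G)
    (hG1 : volume G ≤ 1) (hK : MeasurableSet K) (hKG : K ⊆ G) {ε δ : ℝ} (hε : 0 < ε) (hδ : 0 < δ) :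
    ∃ (U : Set (EucSp n)) (η : ℝ≥0∞), MeasurableSet U ∧ 0 < η ∧
      volume (G ∩ U) ≤ ENNReal.ofReal ((4 / ε + 2) / N) ∧
      ∀ γ : EucSp n ≃ₗᵢ[ℝ] EucSp n, ∃ A, volume A ≤ ENNReal.ofReal ε ∧
        ∀ x ∈ K \ A, B.Good h U η δ γ x := by
  obtain ⟨v, hv, hNv, hlayer⟩ := exists_layer hn hB hh hN0 hN hG hGb
  set d := N * v with hd
  have hd0 : 0 < d := mul_pos hN0 hv
  have key : ∀ m : ℕ, ∃ (U : Set (EucSp n)) (η : ℝ≥0∞)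
      (A : (EucSp n ≃ₗᵢ[ℝ] EucSp n) → Set (EucSp n)), MeasurableSet U ∧ 0 < η ∧
      volume (G ∩ U) ≤ ENNReal.ofReal (m * (2 * v)) ∧ UnifTransCont A ∧
      (∀ γ, MeasurableSet (A γ)) ∧ (∀ γ, A γ ⊆ K) ∧
      (∀ γ, volume.real (A γ) ≤ max ε (1 - m * (d * ε / 2))) ∧
      ∀ γ, ∀ x ∈ K \ A γ, B.Good h U η δ γ x := by
    intro m
    induction m with
    | zero =>
      refine ⟨∅, 1, fun _ => K, MeasurableSet.empty, one_pos, by simp,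
        UnifTransCont.const hK (hGb.subset hKG).measure_lt_top.ne, fun _ => hK, fun _ => subset_rfl,
        fun _ => ?_, by simp⟩
      have : volume.real K ≤ 1 := ENNReal.toReal_le_of_le_ofReal zero_le_one
        (by simpa using (measure_mono hKG).trans hG1)
      simp [this]
    | succ m ih =>
      obtain ⟨U, η, A, hU, hη, hUv, hAu, hAm, hAK, hAv, hA⟩ := ih
      obtain ⟨U', η', W, hU', hη', hWu, hWm, hUv', hAW, hW⟩ := hlayer A hAu hAm
        (fun γ => (hAK γ).trans hKG) (ENNReal.ofReal (min v (d * ε / 2)))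
        (by simpa using ⟨hv, by positivity⟩) δ hδ
      refine ⟨U ∪ U', min η η', fun γ => A γ \ W γ, hU.union hU', lt_min hη hη', ?_,
        hAu.diff hWu, fun γ => (hAm γ).diff (hWm γ), fun γ => sdiff_subset.trans (hAK γ), ?_, ?_⟩
      · rw [inter_union_distrib_left]
        have h1 : volume G * ENNReal.ofReal v + ENNReal.ofReal (min v (d * ε / 2)) ≤
            ENNReal.ofReal (2 * v) := by
          rw [two_mul, ENNReal.ofReal_add hv.le hv.le]
          refine add_le_add (mul_le_of_le_one_left' hG1) (ENNReal.ofReal_le_ofReal (min_le_left _ _))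
        refine (measure_union_le _ _).trans ((add_le_add hUv (hUv'.trans h1)).trans_eq ?_)
        rw [← ENNReal.ofReal_add (by positivity) (by positivity)]
        push_cast
        congr 1
        ring
      · intro γ
        have hfin : ∀ S ⊆ A γ, volume S ≠ ⊤ := fun S hS =>
          (hGb.subset (hS.trans ((hAK γ).trans hKG))).measure_lt_top.ne
        have h1 : volume.real (A γ ∩ W γ) + volume.real (A γ \ W γ) = volume.real (A γ) :=
          measureReal_inter_add_sdiff (hWm γ) (hfin _ subset_rfl)
        have h2 : volume.real (A γ) * d ≤ volume.real (A γ ∩ W γ) + min v (d * ε / 2) := by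
          have h3 := ENNReal.toReal_mono
            (ENNReal.add_ne_top.2 ⟨hfin _ inter_subset_left, ENNReal.ofReal_ne_top⟩) (hAW γ)
          rwa [ENNReal.toReal_mul, ENNReal.toReal_ofReal hd0.le,
            ENNReal.toReal_add (hfin _ inter_subset_left) ENNReal.ofReal_ne_top,
            ENNReal.toReal_ofReal (by positivity)] at h3
        have h4 := min_le_right v (d * ε / 2)
        have h5 : 0 ≤ volume.real (A γ ∩ W γ) := measureReal_nonneg
        rcases le_or_gt (volume.real (A γ)) ε with hle | hgt
        · exact le_max_of_le_left (by linarith)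
        · refine le_max_of_le_right ?_
          have h6 := (le_max_iff.1 (hAv γ)).resolve_left hgt.not_ge
          push_cast
          nlinarith
      · rintro γ x ⟨hxK, hx⟩
        by_cases hxA : x ∈ A γ
        · exact (hW γ x (by_contra fun hxW => hx ⟨hxA, hxW⟩)).mono subset_union_right
            (min_le_right _ _)
        · exact (hA γ x ⟨hxK, hxA⟩).mono subset_union_left (min_le_left _ _)
  obtain ⟨U, η, A, hU, hη, hUv, -, hAm, hAK, hAv, hA⟩ := key ⌈2 / (d * ε)⌉₊
  refine ⟨U, η, hU, hη, hUv.trans (ENNReal.ofReal_le_ofReal ?_), fun γ => ⟨A γ, ?_, hA γ⟩⟩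
  · have h1 := (Nat.ceil_lt_add_one (a := 2 / (d * ε)) (by positivity)).le
    rw [le_div_iff₀ hN0]
    calc (⌈2 / (d * ε)⌉₊ : ℝ) * (2 * v) * N = ⌈2 / (d * ε)⌉₊ * (2 * d) := by rw [hd]; ring
      _ ≤ (2 / (d * ε) + 1) * (2 * d) := by gcongr
      _ = 4 / ε + 2 * d := by field_simp; ring
      _ ≤ 4 / ε + 2 := by linarith
  · have h1 := Nat.le_ceil (2 / (d * ε))
    rw [div_le_iff₀ (by positivity)] at h1
    have h2 := (hAv γ).trans (max_le le_rfl (by linarith))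
    rw [← ofReal_measureReal (hGb.subset ((hAK γ).trans hKG)).measure_lt_top.ne]
    exact ENNReal.ofReal_le_ofReal h2

end DiffBasis

/-! ### The unit cube -/

theorem isOpen_unitCube (n : ℕ) : IsOpen (unitCube n) := by
  have : unitCube n = ⋂ i : Fin n, (fun x : EucSp n => x i) ⁻¹' Ioo (0 : ℝ) 1 := by
    ext x; simp [unitCube]
  rw [this]
  exact isOpen_iInter_of_finite fun i => isOpen_Ioo.preimage (by fun_prop)

theorem volume_unitCube (n : ℕ) : volume (unitCube n) = 1 := by
  have : unitCube n = (WithLp.ofLp : EucSp n → Fin n → ℝ) ⁻¹' univ.pi fun _ => Ioo (0 : ℝ) 1 := by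
    ext x; simp [unitCube]
  rw [this, (PiLp.volume_preserving_ofLp (Fin n)).measure_preimage
    (MeasurableSet.univ_pi fun _ => measurableSet_Ioo).nullMeasurableSet]
  simp [Real.volume_pi_Ioo]

theorem isBounded_unitCube (n : ℕ) : Bornology.IsBounded (unitCube n) := by
  refine (Metric.isBounded_ball (x := (0 : EucSp n)) (r := Real.sqrt n + 1)).subset fun x hx => ?_
  rw [mem_ball_zero_iff, EuclideanSpace.norm_eq]
  refine lt_of_le_of_lt (Real.sqrt_le_sqrt ?_) (lt_add_one _)
  calc ∑ i, ‖x i‖ ^ 2 ≤ ∑ _i : Fin n, (1 : ℝ) := Finset.sum_le_sum fun i _ => by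
        have := hx i
        rw [Real.norm_eq_abs, sq_abs]
        nlinarith [this.1, this.2]
    _ = n := by simp

/-! ### Orlicz spaces -/

namespace YoungFunction

variable {n : ℕ}

/-- A Young function grows at least linearly. -/
theorem exists_le_add_mul (ψ : YoungFunction) :
    ∃ a > 0, ∃ b > 0, ∀ t : ℝ, 0 ≤ t → t ≤ a + b * ψ t := by
  obtain ⟨a, ha, ha0⟩ :=
    ((ψ.tendsto_atTop.eventually_gt_atTop 0).and (eventually_gt_atTop 0)).exists
  refine ⟨a, ha0, a / ψ a, by positivity, fun t ht => ?_⟩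
  rcases le_or_gt t a with hta | hta
  · have : 0 ≤ a / ψ a * ψ t := mul_nonneg (by positivity) (ψ.nonneg ht)
    linarith
  · have ht0 : 0 < t := ha0.trans hta
    have h := ψ.map_combo_le (a := a / t) (b := 1 - a / t) (s := t) (t := 0) (u := a)
      (by positivity) (by rw [sub_nonneg, div_le_one ht0]; exact hta.le) (by ring) ht le_rfl ha0.le
      (by rw [div_mul_cancel₀ _ ht0.ne']; simp)
    rw [ψ.map_zero, mul_zero, add_zero, div_mul_eq_mul_div, le_div_iff₀ ht0] at h
    have : t ≤ a / ψ a * ψ t := by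
      rw [div_mul_eq_mul_div, le_div_iff₀ ha]
      linarith
    linarith

theorem exists_lintegral_enorm_le (ψ : YoungFunction) (n : ℕ) :
    ∃ a > 0, ∃ b > 0, ∀ f : EucSp n → ℝ, AEMeasurable f volume → {x | f x ≠ 0} ⊆ unitCube n →
      ∫⁻ x, ‖f x‖ₑ ≤ ENNReal.ofReal a + ENNReal.ofReal b * ψ.modular f := by
  obtain ⟨a, ha, b, hb, h⟩ := ψ.exists_le_add_mul
  refine ⟨a, ha, b, hb, fun f hf hs => ?_⟩
  have hG := (isOpen_unitCube n).measurableSet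
  have e : ENNReal.ofReal a = ∫⁻ x, (unitCube n).indicator (fun _ => ENNReal.ofReal a) x := by
    rw [lintegral_indicator hG, setLIntegral_const, volume_unitCube, mul_one]
  rw [modular, ← lintegral_const_mul' _ _ ENNReal.ofReal_ne_top, e,
    ← lintegral_add_left (measurable_const.indicator hG)]
  refine lintegral_mono fun x => ?_
  by_cases hx : x ∈ unitCube n
  · rw [indicator_of_mem hx, ← ENNReal.ofReal_mul hb.le,
      ← ENNReal.ofReal_add ha.le (mul_nonneg hb.le (ψ.nonneg (abs_nonneg _))),
      Real.enorm_eq_ofReal_abs]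
    exact ENNReal.ofReal_le_ofReal (h _ (abs_nonneg _))
  · have : f x = 0 := not_not.1 fun hne => hx (hs hne)
    simp [this]

theorem exists_mul_le (ψ : YoungFunction) (hψ : DeltaTwoAtInfinity ψ) {M : ℝ} (hM : 0 ≤ M) :
    ∃ C > 0, ∃ τ > 0, ∀ t > τ, ψ (M * t) ≤ C * ψ t := by
  obtain ⟨c, hc, τ, hτ, h⟩ := hψ
  have key : ∀ j : ℕ, ∀ t > τ, ψ (2 ^ j * t) ≤ c ^ j * ψ t := by
    intro j
    induction j with
    | zero => simp
    | succ j ih =>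
      intro t ht
      have h1 : τ < 2 ^ j * t :=
        ht.trans_le (le_mul_of_one_le_left (hτ.trans ht).le (one_le_pow₀ one_le_two))
      calc ψ (2 ^ (j + 1) * t) = ψ (2 * (2 ^ j * t)) := by ring_nf
        _ ≤ c * ψ (2 ^ j * t) := h _ h1
        _ ≤ c * (c ^ j * ψ t) := by gcongr; exact ih t ht
        _ = c ^ (j + 1) * ψ t := by ring
  obtain ⟨j, hj⟩ := pow_unbounded_of_one_lt M one_lt_two
  refine ⟨c ^ j, by positivity, τ, hτ, fun t ht => ?_⟩
  have ht0 : 0 ≤ t := (hτ.trans ht).le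
  exact (ψ.monotoneOn (mul_nonneg hM ht0) (mul_nonneg (by positivity) ht0) (by gcongr)).trans
    (key j t ht)

theorem modular_lt_top_of_bounded (ψ : YoungFunction) {f : EucSp n → ℝ} {T : ℝ}
    (hs : {x | f x ≠ 0} ⊆ unitCube n) (hT : ∀ x, |f x| ≤ T) : ψ.modular f < ⊤ := by
  have hG := (isOpen_unitCube n).measurableSet
  have h : ψ.modular f ≤ ∫⁻ x, (unitCube n).indicator (fun _ => ENNReal.ofReal (ψ T)) x := by
    refine lintegral_mono fun x => ?_
    by_cases hx : x ∈ unitCube n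
    · rw [indicator_of_mem hx]
      exact ENNReal.ofReal_le_ofReal (ψ.monotoneOn (mem_Ici.2 (abs_nonneg (f x)))
        ((abs_nonneg (f x)).trans (hT x)) (hT x))
    · have : f x = 0 := not_not.1 fun hne => hx (hs hne)
      simp [this, ψ.map_zero]
  refine h.trans_lt ?_
  rw [lintegral_indicator hG, setLIntegral_const, volume_unitCube, mul_one]
  exact ENNReal.ofReal_lt_top

/-- Under `Δ₂`, cutting `f` off at a high level is a small change in the Luxemburg norm. -/
theorem exists_modular_cutoff_le (ψ : YoungFunction) (hψ : DeltaTwoAtInfinity ψ)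
    {f : EucSp n → ℝ} (hf : AEMeasurable f volume) (hf' : ψ.modular f < ⊤) {ε : ℝ} (hε : 0 < ε) :
    ∃ T : ℝ, 0 < T ∧ ψ.modular (fun x => {x | T < |f x|}.indicator f x / ε) ≤ 1 := by
  obtain ⟨C, hC, τ, hτ, h⟩ := ψ.exists_mul_le hψ (inv_nonneg.2 hε.le)
  have hmeas : ∀ T : ℝ, NullMeasurableSet {x | T < |f x|} volume := fun T =>
    nullMeasurableSet_lt aemeasurable_const (measurable_norm.comp_aemeasurable hf)
  have hlim : Tendsto (fun m : ℕ => ∫⁻ x, {x | (m : ℝ) < |f x|}.indicator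
      (fun x => ENNReal.ofReal (ψ |f x|)) x) atTop (𝓝 (∫⁻ _ : EucSp n, 0)) := by
    refine tendsto_lintegral_of_dominated_convergence' (fun x => ENNReal.ofReal (ψ |f x|))
      (fun m => (ψ.aemeasurable_comp hf).indicator₀ (hmeas m))
      (fun m => .of_forall fun x => indicator_le_self _ _ x) hf'.ne (.of_forall fun x => ?_)
    obtain ⟨m₀, hm₀⟩ := exists_nat_ge |f x|
    refine tendsto_const_nhds.congr' ?_
    filter_upwards [eventually_ge_atTop m₀] with m hm
    rw [indicator_of_notMem]
    rw [mem_ofPred_eq, not_lt]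
    exact hm₀.trans (by exact_mod_cast hm)
  rw [lintegral_zero] at hlim
  obtain ⟨m, hm, hmτ⟩ := ((hlim.eventually (ge_mem_nhds
    (ENNReal.ofReal_pos.2 (inv_pos.2 hC)))).and (eventually_gt_atTop ⌈τ⌉₊)).exists
  have hmτ' : τ < m := (Nat.le_ceil τ).trans_lt (by exact_mod_cast hmτ)
  refine ⟨m, hτ.trans hmτ', ?_⟩
  calc ψ.modular (fun x => {x | (m : ℝ) < |f x|}.indicator f x / ε)
      ≤ ∫⁻ x, ENNReal.ofReal C * {x | (m : ℝ) < |f x|}.indicator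
          (fun x => ENNReal.ofReal (ψ |f x|)) x := by
        refine lintegral_mono fun x => ?_
        beta_reduce
        by_cases hx : x ∈ {x | (m : ℝ) < |f x|}
        · rw [indicator_of_mem hx, indicator_of_mem hx, ← ENNReal.ofReal_mul hC.le, abs_div,
            abs_of_pos hε, div_eq_inv_mul]
          exact ENNReal.ofReal_le_ofReal (h _ (hmτ'.trans hx))
        · rw [indicator_of_notMem hx, zero_div, abs_zero, ψ.map_zero, ENNReal.ofReal_zero]
          exact zero_le
    _ = ENNReal.ofReal C * ∫⁻ x, {x | (m : ℝ) < |f x|}.indicator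
          (fun x => ENNReal.ofReal (ψ |f x|)) x :=
        lintegral_const_mul' _ _ ENNReal.ofReal_ne_top
    _ ≤ ENNReal.ofReal C * ENNReal.ofReal C⁻¹ := by gcongr
    _ = 1 := by rw [← ENNReal.ofReal_mul hC.le, mul_inv_cancel₀ hC.ne', ENNReal.ofReal_one]

end YoungFunction

namespace OrliczSpace

variable {n : ℕ} {ψ : YoungFunction}

theorem dist_le_of_modular_le {f g : OrliczSpace ψ n} {a : ℝ} (ha : 0 < a)
    (h : ψ.modular (fun x => (f.1 - g.1) x / a) ≤ 1) : dist f g ≤ a :=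
  csInf_le ⟨0, fun _ hc => hc.1.le⟩ ⟨ha, h⟩

theorem integrable (f : OrliczSpace ψ n) : Integrable f.1 volume := by
  obtain ⟨a, -, b, -, h⟩ := ψ.exists_lintegral_enorm_le n
  refine ⟨f.2.1.aestronglyMeasurable, (h f.1 f.2.1 f.2.2.1).trans_lt ?_⟩
  exact ENNReal.add_lt_top.2 ⟨ENNReal.ofReal_lt_top, ENNReal.mul_lt_top ENNReal.ofReal_lt_top f.2.2.2⟩

/-- The Luxemburg norm dominates the `L¹` norm. -/
theorem exists_integral_abs_sub_le (ψ : YoungFunction) (n : ℕ) :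
    ∃ C > 0, ∀ f g : OrliczSpace ψ n, ∀ ρ, dist f g < ρ → ∫ x, |f.1 x - g.1 x| ≤ C * ρ := by
  obtain ⟨a, ha, b, hb, h⟩ := ψ.exists_lintegral_enorm_le n
  refine ⟨a + b, by positivity, fun f g ρ hρ => ?_⟩
  obtain ⟨c, ⟨hc0, hc⟩, hcρ⟩ := exists_lt_of_csInf_lt
    (ψ.luxNorm_set_nonempty f.2.1 g.2.1 f.2.2.2 g.2.2.2) hρ
  have hs : {x | (f.1 - g.1) x / c ≠ 0} ⊆ unitCube n := by
    intro x hx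
    by_contra hxG
    have h1 : f.1 x = 0 := not_not.1 fun hne => hxG (f.2.2.1 hne)
    have h2 : g.1 x = 0 := not_not.1 fun hne => hxG (g.2.2.1 hne)
    simp [h1, h2] at hx
  have h3 := h _ ((f.2.1.sub g.2.1).div_const c) hs
  have h4 : ∫⁻ x, ‖(f.1 - g.1) x / c‖ₑ ≤ ENNReal.ofReal (a + b) := by
    refine h3.trans ?_
    rw [ENNReal.ofReal_add ha.le hb.le]
    exact add_le_add le_rfl (mul_le_of_le_one_right' hc)
  have h5 : ∫ x, ‖(f.1 - g.1) x / c‖ ≤ a + b := by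
    rw [integral_norm_eq_lintegral_enorm ((f.2.1.sub g.2.1).div_const c).aestronglyMeasurable]
    exact ENNReal.toReal_le_of_le_ofReal (by positivity) h4
  simp only [norm_div, Real.norm_eq_abs, abs_of_pos hc0, integral_div, Pi.sub_apply] at h5
  rw [div_le_iff₀ hc0] at h5
  refine h5.trans ?_
  gcongr

end OrliczSpace

/-! ### Large means for all rotations -/

/-- The functions that, for every linear isometry `γ`, have a mean greater than `k` over some set
of `B(γ)(x)` of diameter less than `1 / (k + 1)`, at all points `x` of the cube outside a set of
measure `1 / (k + 1)`. -/
def largeMeans {n : ℕ} (B : DiffBasis n) (ψ : YoungFunction) (k : ℕ) : Set (OrliczSpace ψ n) :=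
  {f | ∀ γ : EucSp n ≃ₗᵢ[ℝ] EucSp n, ∃ A, volume A ≤ ENNReal.ofReal (1 / (k + 1)) ∧
    ∀ x ∈ unitCube n \ A, ∃ R ∈ (B.rotate γ).sets x, Metric.diam R < 1 / (k + 1) ∧
      (k : ℝ) < (volume.real R)⁻¹ * ∫ y in R, f.1 y}

namespace DiffBasis

variable {n : ℕ}

theorem image_add_mem_rotate {B : DiffBasis n} (hB : B.IsTranslationInvariant)
    (γ : EucSp n ≃ₗᵢ[ℝ] EucSp n) (x : EucSp n) {I : Set (EucSp n)} (hI : I ∈ B.sets 0) :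
    (fun y => x + γ y) '' I ∈ (B.rotate γ).sets x := by
  refine ⟨(fun y => x + y) '' I, ?_, ?_⟩
  · rw [hB x]
    exact ⟨I, hI, rfl⟩
  · rw [image_image]
    simp [rotateAt]

theorem diam_image_add_isometry (γ : EucSp n ≃ₗᵢ[ℝ] EucSp n) (x : EucSp n) (I : Set (EucSp n)) :
    Metric.diam ((fun y => x + γ y) '' I) = Metric.diam I :=
  ((isometry_add_left x).comp γ.isometry).diam_image I

/-- At a good point, a function close in `L¹` to a bounded perturbation of `M h χ_{G ∩ U}` has a
large mean: the lower bound `η` for `|R|` controls the mean of the `L¹`-error. -/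
theorem Good.lt_mean {B : DiffBasis n} {h : ℝ} (hh : 0 < h) {U : Set (EucSp n)} {η δ : ℝ}
    {γ : EucSp n ≃ₗᵢ[ℝ] EucSp n} {x : EucSp n}
    (hx : B.Good h U (ENNReal.ofReal η) δ γ x) {G : Set (EucSp n)} (hG : MeasurableSet G)
    (hU : MeasurableSet U) (hη : 0 ≤ η) (hxG : Metric.ball x δ ⊆ G) {f u : EucSp n → ℝ}
    (hf : Integrable f) (hu : Integrable u) {T M : ℝ} (hT : ∀ y, |u y| ≤ T) (hM : 0 < M)
    (hfu : ∫ y, |f y - (u y + (G ∩ U).indicator (fun _ => M * h) y)| ≤ η)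
    (hGU : volume (G ∩ U) ≠ ⊤) :
    ∃ I ∈ B.sets 0, Metric.diam I < δ ∧ M - T - 1 <
      (volume.real ((fun y => x + γ y) '' I))⁻¹ * ∫ y in (fun y => x + γ y) '' I, f y := by
  obtain ⟨I, hI, hd, hv, hm⟩ := hx
  refine ⟨I, hI, hd, ?_⟩
  set R := (fun y => x + γ y) '' I with hR
  have hvR : volume R = volume I := volume_image_add_isometry γ x I
  have hIt : volume I ≠ ⊤ := (B.isBounded 0 I hI).measure_lt_top.ne
  have hRG : R ⊆ G := by
    rintro _ ⟨y, hy, rfl⟩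
    refine hxG ?_
    have h1 := Metric.dist_le_diam_of_mem (B.isBounded 0 I hI) hy (B.mem 0 I hI)
    rw [dist_zero_right] at h1
    rw [Metric.mem_ball, dist_eq_norm, add_sub_cancel_left, γ.norm_map]
    exact h1.trans_lt hd
  rw [← hvR] at hv hm hIt
  set w := volume.real R with hw
  have hwη : η < w := by
    rw [hw, Measure.real]
    exact (ENNReal.ofReal_lt_iff_lt_toReal hη hIt).1 hv
  have hw0 : 0 < w := hη.trans_lt hwη
  have hRU : R ∩ (G ∩ U) = R ∩ U := by rw [← inter_assoc, inter_eq_left.2 hRG]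
  have hRUt : volume (R ∩ U) ≠ ⊤ := ((measure_mono inter_subset_left).trans_lt hIt.lt_top).ne
  have hm' : w < h * volume.real (R ∩ U) := by
    have h1 := (ENNReal.toReal_lt_toReal hIt (ENNReal.mul_ne_top ENNReal.ofReal_ne_top hRUt)).2 hm
    rwa [ENNReal.toReal_mul, ENNReal.toReal_ofReal hh.le] at h1
  set g := (G ∩ U).indicator fun _ : EucSp n => M * h with hg
  have hgi : Integrable g := (integrable_indicator_iff (hG.inter hU)).2 (integrableOn_const hGU)
  have hgR : ∫ y in R, g y = M * h * volume.real (R ∩ U) := by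
    rw [hg, integral_indicator (hG.inter hU), setIntegral_const, measureReal_def,
      Measure.restrict_apply (hG.inter hU), inter_comm, hRU, smul_eq_mul, mul_comm]
    rfl
  have huR : -(T * w) ≤ ∫ y in R, u y := by
    have h1 := norm_setIntegral_le_of_norm_le_const (f := u) hIt.lt_top fun y _ => hT y
    rw [Real.norm_eq_abs] at h1
    exact (abs_le.1 h1).1
  have heR : -η ≤ ∫ y in R, (f y - (u y + g y)) := by
    have hi : Integrable fun y => f y - (u y + g y) := hf.sub (hu.add hgi)
    have h1 : |∫ y in R, (f y - (u y + g y))| ≤ η :=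
      (abs_integral_le_integral_abs).trans
        ((setIntegral_le_integral hi.abs (.of_forall fun _ => abs_nonneg _)).trans hfu)
    exact (abs_le.1 h1).1
  have hsum : ∫ y in R, f y =
      (∫ y in R, (f y - (u y + g y))) + ((∫ y in R, u y) + ∫ y in R, g y) := by
    have hug : Integrable fun y => u y + g y := hu.add hgi
    rw [integral_sub hf.integrableOn hug.integrableOn,
      integral_add hu.integrableOn hgi.integrableOn]
    ring
  rw [lt_inv_mul_iff₀ hw0, hsum, hgR]
  nlinarith

end DiffBasis

section Density

variable {n : ℕ} {B : DiffBasis n} {ψ : YoungFunction}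

theorem eventually_ofReal_mul_lt_Phi (hlim : Tendsto (fun h : ℝ => ENNReal.ofReal (ψ h) / B.Phi h) atTop (𝓝 0))
    {C : ℝ} (hC : 0 < C) :
    ∀ᶠ h : ℝ in atTop, 0 < ψ h ∧ ENNReal.ofReal (C * ψ h) < B.Phi h := by
  filter_upwards [hlim.eventually (gt_mem_nhds (ENNReal.ofReal_pos.2 (inv_pos.2 hC))),
    ψ.tendsto_atTop.eventually_gt_atTop 0] with h h1 h2
  have h3 : ENNReal.ofReal (ψ h) ≠ 0 := (ENNReal.ofReal_pos.2 h2).ne'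
  rw [ENNReal.div_lt_iff (Or.inr h3) (Or.inr ENNReal.ofReal_ne_top)] at h1
  refine ⟨h2, ?_⟩
  have h4 := ENNReal.mul_lt_mul_right (ENNReal.ofReal_pos.2 hC).ne' ENNReal.ofReal_ne_top h1
  rwa [← mul_assoc, ← ENNReal.ofReal_mul hC.le, ← ENNReal.ofReal_mul hC.le, mul_inv_cancel₀ hC.ne',
    ENNReal.ofReal_one, one_mul] at h4

/-- Density of the interior of `largeMeans B ψ k`: cut `f` off at a level `T` and add the spikes
`M h χ_U` of the covering. The number `h` is chosen so that `Φ_B(h)` beats `ψ` at the dilated height,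
which makes `|U|` small enough for the spikes to have small norm. -/
theorem exists_ball_subset_largeMeans (hn : n ≠ 0) (hB : B.IsTranslationInvariant)
    (hψ : DeltaTwoAtInfinity ψ)
    (hlim : Tendsto (fun h : ℝ => ENNReal.ofReal (ψ h) / B.Phi h) atTop (𝓝 0)) (k : ℕ)
    (f : OrliczSpace ψ n) {ε : ℝ} (hε : 0 < ε) :
    ∃ (g : OrliczSpace ψ n) (ρ : ℝ), 0 < ρ ∧ dist f g ≤ ε ∧ Metric.ball g ρ ⊆ largeMeans B ψ k := by
  classical
  have hGo := isOpen_unitCube n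
  have hG := hGo.measurableSet
  obtain ⟨T, hT0, hT⟩ := ψ.exists_modular_cutoff_le hψ f.2.1 f.2.2.2 (half_pos hε)
  set ε' : ℝ := 1 / (k + 1) / 2 with hε'
  have hε'0 : 0 < ε' := by positivity
  set M : ℝ := T + k + 1 with hM
  have hM0 : 0 < M := by positivity
  obtain ⟨K, hKG, hKc, hKv⟩ := hG.exists_isCompact_sdiff_lt (μ := volume)
    (by rw [volume_unitCube]; exact ENNReal.one_ne_top) (ENNReal.ofReal_pos.2 hε'0).ne'
  obtain ⟨δ₀, hδ₀, hKδ⟩ := hKc.exists_thickening_subset_open hGo hKG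
  -- The spikes have height `M h`; their modular at scale `ε / 2` is compared with `ψ h`.
  obtain ⟨C, hC, τ, hτ, hCτ⟩ := ψ.exists_mul_le hψ (M := M / (ε / 2)) (by positivity)
  obtain ⟨h, ⟨hψh, hΦh⟩, hhτ⟩ := ((eventually_ofReal_mul_lt_Phi hlim (C := (4 / ε' + 2) * C)
    (by positivity)).and (eventually_gt_atTop τ)).exists
  have hh0 : 0 < h := hτ.trans hhτ
  obtain ⟨U, η, hU, hη, hUv, hgood⟩ := DiffBasis.exists_covering hn hB hh0.le (by positivity) hΦh
    hG (isBounded_unitCube n) (volume_unitCube n).le hKc.measurableSet hKG hε'0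
    (lt_min hδ₀ (show (0 : ℝ) < 1 / (k + 1) by positivity))
  have hUv' : volume (unitCube n ∩ U) ≤ ENNReal.ofReal (C * ψ h)⁻¹ := by
    refine hUv.trans_eq (congrArg _ ?_)
    field_simp
  set η₁ : ℝ := (min η 1).toReal with hη₁
  have hη₁t : min η 1 ≠ ⊤ := ((min_le_right _ _).trans_lt ENNReal.one_lt_top).ne
  have hη₁0 : 0 < η₁ := ENNReal.toReal_pos (lt_min hη one_pos).ne' hη₁t
  obtain ⟨C₁, hC₁, hL1⟩ := OrliczSpace.exists_integral_abs_sub_le ψ n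
  set S := {x | T < |f.1 x|} with hS
  have hSm : NullMeasurableSet S volume :=
    nullMeasurableSet_lt aemeasurable_const (measurable_norm.comp_aemeasurable f.2.1)
  set u : EucSp n → ℝ := Sᶜ.indicator f.1 with hu
  have hum : AEMeasurable u volume := f.2.1.indicator₀ hSm.compl
  have huT : ∀ x, |u x| ≤ T := fun x => by
    by_cases hx : x ∈ S
    · rw [hu, indicator_of_notMem (by simpa using hx), abs_zero]
      exact hT0.le
    · rw [hu, indicator_of_mem (by simpa using hx)]
      exact not_lt.1 hx
  have hus : {x | u x ≠ 0} ⊆ unitCube n := fun x hx => by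
    by_contra hxG
    have : f.1 x = 0 := not_not.1 fun hne => hxG (f.2.2.1 hne)
    exact hx (by simp [hu, indicator_apply, this])
  set v : EucSp n → ℝ := (unitCube n ∩ U).indicator fun _ => M * h with hv
  have hvm : AEMeasurable v volume := (measurable_const.indicator (hG.inter hU)).aemeasurable
  have hvs : ∀ x, x ∉ unitCube n → v x = 0 := fun x hx => by
    rw [hv, indicator_of_notMem fun hx' => hx hx'.1]
  let fu : OrliczSpace ψ n := ⟨u, hum, hus, ψ.modular_lt_top_of_bounded hus huT⟩
  have huvs : {x | u x + v x ≠ 0} ⊆ unitCube n := fun x hx => by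
    by_contra hxG
    have : u x = 0 := not_not.1 fun hne => hxG (hus hne)
    exact hx (by rw [this, hvs x hxG, add_zero])
  have hvb : ∀ x, |v x| ≤ M * h := fun x => by
    rw [hv, indicator_apply]
    split_ifs
    · exact (abs_of_pos (by positivity)).le
    · rw [abs_zero]; positivity
  let g : OrliczSpace ψ n := ⟨fun x => u x + v x, hum.add hvm, huvs,
    ψ.modular_lt_top_of_bounded huvs fun x => (abs_add_le _ _).trans (add_le_add (huT x) (hvb x))⟩
  have hd1 : dist f fu ≤ ε / 2 := by
    refine OrliczSpace.dist_le_of_modular_le (half_pos hε) ?_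
    have e : (f.1 - fu.1) = S.indicator f.1 := by
      change f.1 - Sᶜ.indicator f.1 = _
      rw [sub_eq_iff_eq_add, indicator_self_add_compl]
    rw [e]
    exact hT
  have hd2 : dist fu g ≤ ε / 2 := by
    refine OrliczSpace.dist_le_of_modular_le (half_pos hε) ?_
    have e : ∀ x, ENNReal.ofReal (ψ |(fu.1 - g.1) x / (ε / 2)|) =
        (unitCube n ∩ U).indicator (fun _ => ENNReal.ofReal (ψ (M / (ε / 2) * h))) x := by
      intro x
      have e1 : (fu.1 - g.1) x = -v x := by
        change u x - (u x + v x) = _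
        ring
      rw [e1, abs_div, abs_neg, hv, indicator_apply, indicator_apply]
      split_ifs
      · rw [abs_of_pos (by positivity), abs_of_pos (by positivity), div_mul_eq_mul_div]
      · simp [ψ.map_zero]
    rw [YoungFunction.modular, lintegral_congr e, lintegral_indicator (hG.inter hU),
      setLIntegral_const]
    calc ENNReal.ofReal (ψ (M / (ε / 2) * h)) * volume (unitCube n ∩ U)
        ≤ ENNReal.ofReal (C * ψ h) * ENNReal.ofReal (C * ψ h)⁻¹ := by
          gcongr
          exact hCτ h hhτ
      _ = 1 := by
          rw [← ENNReal.ofReal_mul (by positivity), mul_inv_cancel₀ (by positivity),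
            ENNReal.ofReal_one]
  refine ⟨g, η₁ / C₁, by positivity, ?_, ?_⟩
  · linarith [dist_triangle f fu g]
  intro φ hφ γ
  have hφL : ∫ x, |φ.1 x - g.1 x| ≤ η₁ := by
    have := hL1 φ g _ hφ
    rwa [mul_div_cancel₀ _ hC₁.ne'] at this
  obtain ⟨A, hA, hAg⟩ := hgood γ
  refine ⟨A ∪ (unitCube n \ K), ?_, ?_⟩
  · refine (measure_union_le _ _).trans ((add_le_add hA hKv.le).trans_eq ?_)
    rw [← ENNReal.ofReal_add hε'0.le hε'0.le, hε', add_halves]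
  · rintro x ⟨hxG, hx⟩
    have hxK : x ∈ K := by_contra fun hxK => hx (Or.inr ⟨hxG, hxK⟩)
    have hxg := hAg x ⟨hxK, fun hxA => hx (Or.inl hxA)⟩
    have hxg' := hxg.mono (η' := ENNReal.ofReal η₁) subset_rfl
      (by rw [hη₁, ENNReal.ofReal_toReal hη₁t]; exact min_le_left _ _)
    have hball : Metric.ball x (min δ₀ (1 / (k + 1))) ⊆ unitCube n := fun y hy =>
      hKδ (Metric.mem_thickening_iff.2 ⟨x, hxK, (Metric.mem_ball.1 hy).trans_le (min_le_left _ _)⟩)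
    obtain ⟨I, hI, hId, hIm⟩ := hxg'.lt_mean hh0 hG hU hη₁0.le hball φ.integrable fu.integrable
      huT hM0 hφL ((measure_mono inter_subset_left).trans_lt
        (by rw [volume_unitCube]; exact ENNReal.one_lt_top)).ne
    refine ⟨_, DiffBasis.image_add_mem_rotate hB γ x hI, ?_, ?_⟩
    · rw [DiffBasis.diam_image_add_isometry]
      exact hId.trans_le (min_le_right _ _)
    · refine lt_of_eq_of_lt ?_ hIm
      rw [hM]; ring

end Density

/-! ### Category -/

theorem upperDeriv_eq_top {n : ℕ} {B : DiffBasis n} {f : EucSp n → ℝ} {x : EucSp n}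
    (h : ∃ᶠ k : ℕ in atTop, ∃ R ∈ B.sets x, Metric.diam R < 1 / (k + 1) ∧
      (k : ℝ) < (volume.real R)⁻¹ * ∫ y in R, f y) : B.upperDeriv f x = ⊤ := by
  refine iInf₂_eq_top.2 fun δ hδ => EReal.eq_top_iff_forall_lt _ |>.2 fun c => ?_
  have h0 : ∀ᶠ k : ℕ in atTop, (1 : ℝ) / (k + 1) < δ :=
    tendsto_one_div_add_atTop_nhds_zero_nat.eventually (gt_mem_nhds hδ)
  have h1 : ∀ᶠ k : ℕ in atTop, c < (k : ℝ) :=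
    tendsto_natCast_atTop_atTop.eventually_gt_atTop c
  obtain ⟨k, ⟨R, hR, hd, hm⟩, hk, hc⟩ := (h.and_eventually (h0.and h1)).exists
  refine lt_of_lt_of_le (EReal.coe_lt_coe_iff.2 (hc.trans hm)) ?_
  exact le_iSup₂_of_le R hR (le_iSup_of_le (hd.trans hk) le_rfl)

theorem mem_classS_of_forall_mem_largeMeans {n : ℕ} {B : DiffBasis n} {ψ : YoungFunction}
    {f : OrliczSpace ψ n} (hf : ∀ k, f ∈ largeMeans B ψ k) : f.1 ∈ classS B.rotations := by
  refine ⟨f.integrable, f.2.2.1, ?_⟩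
  rintro _ ⟨γ, -, rfl⟩
  choose A hA hAx using fun k => hf k γ
  have hnull : ∀ m : ℕ, volume (⋂ k ≥ m, A k) = 0 := by
    intro m
    have hlim : Tendsto (fun k : ℕ => ENNReal.ofReal (1 / ((k : ℝ) + 1))) atTop (𝓝 0) := by
      simpa using ENNReal.tendsto_ofReal tendsto_one_div_add_atTop_nhds_zero_nat
    refine le_antisymm (ge_of_tendsto hlim ?_) zero_le
    filter_upwards [eventually_ge_atTop m] with k hk
    exact (measure_mono (biInter_subset_of_mem hk)).trans (hA k)
  rw [ae_restrict_iff' (isOpen_unitCube n).measurableSet]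
  filter_upwards [measure_eq_zero_iff_ae_notMem.1 (measure_iUnion_null hnull)] with x hx hxG
  refine upperDeriv_eq_top (frequently_atTop.2 fun m => ?_)
  have hxm : x ∉ ⋂ k ≥ m, A k := fun h => hx (mem_iUnion.2 ⟨m, h⟩)
  simp only [mem_iInter, not_forall] at hxm
  obtain ⟨k, hk, hxk⟩ := hxm
  exact ⟨k, hk, hAx k x ⟨hxG, hxk⟩⟩

theorem theorem3 {n : ℕ} (hn : 2 ≤ n) (B : DiffBasis n) (hB : B.IsTranslationInvariant)
    (hΦ : NonRegular B.Phi) (ψ : YoungFunction) (hψ : DeltaTwoAtInfinity ψ)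
    (hlim : Tendsto (fun h : ℝ => ENNReal.ofReal (ψ h) / B.Phi h) atTop (𝓝 0)) :
    IsMeagre {f : OrliczSpace ψ n | f.1 ∉ classS B.rotations} := by
  have hres : ∀ k, interior (largeMeans B ψ k) ∈ residual (OrliczSpace ψ n) := by
    refine fun k => residual_of_dense_open isOpen_interior (Metric.dense_iff.2 fun f ε hε => ?_)
    obtain ⟨g, ρ, hρ, hfg, hg⟩ :=
      exists_ball_subset_largeMeans (by omega) hB hψ hlim k f (half_pos hε)
    refine ⟨g, ?_, interior_maximal hg Metric.isOpen_ball (Metric.mem_ball_self hρ)⟩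
    rw [Metric.mem_ball, dist_comm]
    linarith
  rw [IsMeagre]
  filter_upwards [countable_iInter_mem.2 hres] with f hf
  exact not_not.2 (mem_classS_of_forall_mem_largeMeans fun k =>
    interior_subset (mem_iInter.1 hf k))
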